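/- Let $k\ge 2$ and let $L=\{E\}$ with $E$ a $k$-ary relation symbol. Write $[n]=\{0,\dots,n-1\}$, $\lambda$ for the uniform measure on $[0,1]$ (and its powers), and $\mathfrak P_{<k}(V)$, $\mathfrak P_{k}(V)$, $\mathfrak P_{\le k}(V)$ for the sets of subsets of $V$ with fewer than $k$, exactly $k$, at most $k$ elements. *Definitions.* Let $\mathfrak{qf}$ be the (finite) set of complete non-redundant quantifier-free $L$-types in variables $x_0,\dots,x_{k-1}$, i.e. those containing $x_i\ne x_j$ for $i\neq j$ and $\neg E(x_{i_0},\dots,x_{i_{k-1}})$ whenever the $i_j$ are not distinct; let $u_\top,u_\bot\in\mathfrak{qf}$ be the types in which $E$ holds of all, respectively none, of the tuples of distinct variables, and $\delta_\top,\delta_\bot$ the point masses at them. $\mathrm{Sym}(k)$ acts on $\mathfrak{qf}$ by permuting variables, and on probability measures $\nu$ on $\mathfrak{qf}$ by $(\sigma\cdot\nu)(B)=\nu(\sigma\cdot B)$. An *extended hypergraphon* is a measurable map $W$ from $[0,1]^{\mathfrak P_{<k}([k])}$ to the probability measures on $\mathfrak{qf}$ such that $W(\langle x_{\sigma(F)}\rangle_F)=\sigma\cdot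 W(\langle x_F\rangle_F)$ for all $x$ and all $\sigma\in\mathrm{Sym}(k)$. The random structure $G(\mathbb N,W)$ on $\mathbb N$ is obtained as follows: let $W^*$ be a measurable function such that $W^*(t,\zeta)$ has distribution $W(t)$ for $\zeta$ uniform on $[0,1]$, let $\langle\zeta_D\rangle_{D\in\mathfrak P_{\le k}(\mathbb N)}$ be i.i.d. uniform on $[0,1]$, and for each $J\in\mathfrak P_k(\mathbb N)$ with increasing enumeration $\tau_J:[k]\to J$ let the quantifier-free type of $(\tau_J(0),\dots,\tau_J(k-1))$ be $W^*(\langle\zeta_{\tau_J(F)}\rangle_{F\in\mathfrak P_{<k}([k])},\zeta_J)$; $E$ holds of no tuple with a repetition. Its *entropy function* $\mathrm{Ent}_W(n)$ is the Shannon entropy (base $2$) of the restriction of $G(\mathbb N,W)$ to $[n]$. We say that $W$ *induces a Borel hypergraph* if $W(x)=W(y)$ for almost every pair $x,y$ with $x_{\{i\}}=y_{\{i\}}$ for all $i\in[k]$, and $W(x)\in\{\delta_\top,\delta_\bot\}$ for almost every $x$. The *Rado $k$-hypergraph* is the countable $k$-uniform hypergraph, unique up to isomorphism, in which every extension of a finite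 induced subhypergraph by one vertex to a $k$-uniform hypergraph is realized by some vertex. For a $k$-uniform hypergraph $M$ on $\mathbb N$ and a Borel map $\pi:[0,1]\to\mathbb N$ with $\lambda(\pi^{-1}(i))>0$ for all $i$, the *$\pi$-blow up* of $M$ is the extended hypergraphon with $W(x)=\delta_\top$ if $\{\pi(x_{\{0\}}),\dots,\pi(x_{\{k-1\}})\}$ is an edge (of $k$ distinct vertices) of $M$ and $W(x)=\delta_\bot$ otherwise. **Theorem.** Let $\gamma:\mathbb N\to[0,1]$ satisfy $\lim_{n\to\infty}\gamma(n)=0$. Then there is an extended hypergraphon $W$ that induces a Borel hypergraph, and which can be taken to be the $\pi$-blow up of (an instantiation on $\mathbb N$ of) the Rado $k$-hypergraph for some Borel $\pi$ as above, such that $\mathrm{Ent}_W$ is finite-valued, $\mathrm{Ent}_W(n)=o(n^k)$ and $\mathrm{Ent}_W(n)=\Omega(\gamma(n)\,n^k)$. -/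

import Mathlib

open MeasureTheory ProbabilityTheory Filter
open scoped ENNReal

/-! Throughout, `E` is a single `k`-ary relation symbol and the language is `{E}`. -/

/-- An `{E}`-structure with underlying set `V`: the interpretation of the `k`-ary symbol `E`.
The `σ`-algebra is the product one, generated by the sets `{M | M a}` for `a : Fin k → V`. -/
abbrev Str (k : ℕ) (V : Type*) : Type _ := (Fin k → V) → Prop

namespace Str

/-- `E` holds only of tuples of distinct elements. -/
def NonRedundant {k : ℕ} {V : Type*} (M : Str k V) : Prop :=
  ∀ a, M a → Function.Injective a

/-- `M` is a `k`-uniform hypergraph: non-redundant and symmetric. -/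
def IsHypergraph {k : ℕ} {V : Type*} (M : Str k V) : Prop :=
  M.NonRedundant ∧ ∀ (s : Equiv.Perm (Fin k)) (a : Fin k → V), M a ↔ M (a ∘ s)

/-- Restriction of a structure on `ℕ` to `{0, …, n - 1}`. -/
def restrict {k : ℕ} (n : ℕ) (M : Str k ℕ) : Str k (Fin n) :=
  fun a => M fun i => (a i : ℕ)

/-- `M` is (an instantiation on the vertex set `ℕ` of) the Rado `k`-hypergraph: a `k`-uniform
hypergraph such that every one-vertex extension `N` (the new vertex is `none`) of a finite induced
subhypergraph `D`, to a `k`-uniform hypergraph, is realized by some vertex `v` outside `D`. -/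
def IsRado {k : ℕ} (M : Str k ℕ) : Prop :=
  M.IsHypergraph ∧
  ∀ (D : Finset ℕ) (N : Str k (Option D)), N.IsHypergraph →
    (∀ a : Fin k → D, N (fun i => some (a i)) ↔ M (fun i => (a i : ℕ))) →
    ∃ v, v ∉ D ∧
      ∀ a : Fin k → Option D, N a ↔ M (fun i => (a i).elim v (fun d => (d : ℕ)))

end Str

/-- Complete non-redundant quantifier-free types in the variables `x_0, …, x_{k-1}`. Such a type `u`
contains `x_i ≠ x_j` for `i ≠ j`, so it is determined by the set of atomic formulas
`E(x_{f 0}, …, x_{f (k-1)})`, `f : Fin k → Fin k`, that it contains (`u.1 f` says that it contains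
this one); non-redundance says that `f` must then be injective. -/
abbrev QfType (k : ℕ) : Type := {u : Str k (Fin k) // u.NonRedundant}

namespace QfType

/-- The type in which `E` holds of all tuples of distinct variables. -/
def top (k : ℕ) : QfType k := ⟨fun f => Function.Injective f, fun _ h => h⟩

/-- The type in which `E` holds of no tuple. -/
def bot (k : ℕ) : QfType k := ⟨fun _ => False, fun _ h => h.elim⟩

instance (k : ℕ) : Nonempty (QfType k) := ⟨bot k⟩

instance (k : ℕ) : StandardBorelSpace (QfType k) := inferInstance

/-- The action `s • u = {φ(x_{s i₀}, …) | φ(x_{i₀}, …) ∈ u}`, that is, `E(x_{f 0}, …)` is in `s • u`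
exactly when `E(x_{s⁻¹ (f 0)}, …)` is in `u`. -/
def act {k : ℕ} (s : Equiv.Perm (Fin k)) (u : QfType k) : QfType k :=
  ⟨fun f => u.1 fun i => s⁻¹ (f i), fun f h i j hij => u.2 _ h (by simp [hij])⟩

end QfType

/-- The subsets of `V` with fewer than `k` elements. -/
abbrev SubsetsLT (k : ℕ) (V : Type*) : Type _ := {F : Finset V // F.card < k}

/-- The subsets of `V` with at most `k` elements. -/
abbrev SubsetsLE (k : ℕ) (V : Type*) : Type _ := {F : Finset V // F.card ≤ k}

/-- The image `s(F)` of a subset `F` of `{0, …, k - 1}` with fewer than `k` elements. -/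
def permSubset {k : ℕ} (s : Equiv.Perm (Fin k)) (F : SubsetsLT k (Fin k)) : SubsetsLT k (Fin k) :=
  ⟨F.1.map s.toEmbedding, by simpa using F.2⟩

/-- Extended hypergraphons for the language `{E}`: probability kernels from
`[0,1]^{F ⊊ {0, …, k-1}}` to the quantifier-free types, compatible with permutations: where
`(s • ν) B = ν (s • B)`, we have `W ((x_{s F})_F) = s • W ((x_F)_F)`. -/
structure ExtHypergraphon (k : ℕ) where
  kernel : Kernel (SubsetsLT k (Fin k) → unitInterval) (QfType k)
  isMarkovKernel : IsMarkovKernel kernel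
  coherent : ∀ (s : Equiv.Perm (Fin k)) (x : SubsetsLT k (Fin k) → unitInterval)
    (B : Set (QfType k)), MeasurableSet B →
    kernel (fun F => x (permSubset s F)) B = kernel x (QfType.act s '' B)

namespace ExtHypergraphon

/-- Every extended hypergraphon has a randomization `f`: it is jointly measurable, and `f t ζ` has
distribution `W t` if `ζ` is uniform on `[0,1]`. -/
theorem exists_randomization {k : ℕ} (W : ExtHypergraphon k) :
    ∃ f : (SubsetsLT k (Fin k) → unitInterval) → unitInterval → QfType k,
      Measurable (Function.uncurry f) ∧ ∀ t, volume.map (f t) = W.kernel t :=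
  haveI := W.isMarkovKernel
  Kernel.exists_measurable_map_eq_unitInterval W.kernel

/-- A choice of randomization `W*` of `W`. -/
noncomputable def randomization {k : ℕ} (W : ExtHypergraphon k) :
    (SubsetsLT k (Fin k) → unitInterval) → unitInterval → QfType k :=
  W.exists_randomization.choose

/-- For `J ⊆ V` with `k` elements, enumerated increasingly by `τ_J`, the sequence
`x̂_J = (x_{τ_J(F)})_F`, where `F` ranges over the subsets of `{0, …, k-1}` with fewer than `k`
elements. -/
def hat {k : ℕ} {V : Type*} [LinearOrder V] (x : SubsetsLE k V → unitInterval)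
    (J : Finset V) (hJ : J.card = k) : SubsetsLT k (Fin k) → unitInterval :=
  fun F => x ⟨F.1.map (J.orderEmbOfFin hJ).toEmbedding, by simpa using F.2.le⟩

/-- The structure `M(V, W)(x)`: for each `k`-element set `J`, the quantifier-free type of the
increasing enumeration `τ_J` of `J` is `W*(x̂_J, x_J)`, and `E` holds of no tuple with repetitions.
So `E` holds of `a` exactly when `a = τ_J ∘ f` for some `J` and some `f` such that
`E(x_{f 0}, …, x_{f (k-1)})` is in `W*(x̂_J, x_J)`. -/
def toStr {k : ℕ} {V : Type*} [LinearOrder V] (W : ExtHypergraphon k)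
    (x : SubsetsLE k V → unitInterval) : Str k V :=
  fun a => ∃ (J : Finset V) (hJ : J.card = k) (f : Fin k → Fin k),
    (∀ i, a i = J.orderEmbOfFin hJ (f i)) ∧ (W.randomization (hat x J hJ) (x ⟨J, hJ.le⟩)).1 f

/-- The distribution of the random structure `G(ℕ, W) = M(ℕ, W)((ζ_D)_D)`, where the `ζ_D` are
i.i.d. uniform on `[0,1]`, indexed by the subsets `D` of `ℕ` with at most `k` elements. -/
noncomputable def law {k : ℕ} (W : ExtHypergraphon k) : Measure (Str k ℕ) :=
  (Measure.infinitePi fun _ : SubsetsLE k ℕ => (volume : Measure unitInterval)).map W.toStr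

/-- Replace the coordinates of `y` at the singletons by those of `x`. -/
def glue {k : ℕ} (x y : SubsetsLT k (Fin k) → unitInterval) :
    SubsetsLT k (Fin k) → unitInterval :=
  fun F => if F.1.card = 1 then x F else y F

/-- `W` induces a Borel hypergraph: for almost every pair of sequences that agree at the singletons
(such a pair is `x`, `glue x y` for independent uniform `x`, `y`), `W` has the same value at both,
and almost everywhere the value of `W` is one of the point masses at `top`, `bot`. -/
def InducesBorelHypergraph {k : ℕ} (W : ExtHypergraphon k) : Prop :=
  (∀ᵐ p : (SubsetsLT k (Fin k) → unitInterval) × (SubsetsLT k (Fin k) → unitInterval),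
    W.kernel p.1 = W.kernel (glue p.1 p.2)) ∧
  ∀ᵐ x : SubsetsLT k (Fin k) → unitInterval,
    W.kernel x = Measure.dirac (QfType.top k) ∨ W.kernel x = Measure.dirac (QfType.bot k)

open Classical in
/-- For `k ≥ 2`: `π : [0,1] → ℕ` is a Borel map all of whose fibres have positive measure, and `W`
is the `π`-blow up of `M`, which depends only on the coordinates `x_{{0}}, …, x_{{k-1}}`. -/
def IsBlowUp {k : ℕ} (hk : 2 ≤ k) (W : ExtHypergraphon k) (π : unitInterval → ℕ) (M : Str k ℕ) :
    Prop :=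
  Measurable π ∧ (∀ i, 0 < volume (π ⁻¹' {i})) ∧
  ∀ x : SubsetsLT k (Fin k) → unitInterval,
    W.kernel x =
      if M (fun i => π (x ⟨{i}, by rw [Finset.card_singleton]; exact hk⟩))
      then Measure.dirac (QfType.top k) else Measure.dirac (QfType.bot k)

end ExtHypergraphon

open Classical in
/-- Entropy, to base `2`, of a probability measure `ν`: the sum of `-ν{s} log₂ ν{s}` over the atoms
`s` if the set of atoms has measure `1`, and `∞` otherwise. -/
noncomputable def entropy {S : Type*} [MeasurableSpace S] (ν : Measure S) : ℝ≥0∞ :=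
  if ν {s | 0 < ν {s}} = 1 then
    ∑' s : {s : S // 0 < ν {s}}, ENNReal.ofReal (-(ν.real {s.1} * Real.logb 2 (ν.real {s.1})))
  else ⊤

/-- The entropy function of a probability measure `μ` on the structures on `ℕ`: the entropy of the
distribution of the restriction to `{0, …, n - 1}`. -/
noncomputable def entropyFunction {k : ℕ} (μ : Measure (Str k ℕ)) (n : ℕ) : ℝ≥0∞ :=
  entropy (μ.map (Str.restrict n))

/-!
The hypergraph is built on a partition of `ℕ` into finite blocks. Each vertex `v` of block `j`
carries a set `link v` of finite sets of vertices of lower blocks, and a set of `k` vertices is an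
edge if one of them lies in a higher block than the others and has the set of these others in its
link. Within a block every possible trace of the link on a given finite family is attained, and all
are attained equally often (`BlockSystem`). That all are attained gives the extension property of
the Rado hypergraph (`BlockSystem.graph_isRado`); the sizes of the blocks can be made as large as
desired (`BlockSystem.exists_le_card`). Vertices are drawn from the measure that gives block `j` the
weight `2 ^ -(j + 1)`, spread evenly, and `π` is a map of `[0,1]` with this distribution. The
structure `G(ℕ, W)` of the blow up is then almost surely the structure induced on independently
drawn vertices (`ExtHypergraphon.IsBlowUp.map_restrict_law`).

Upper bound, for any measure on the vertices: outside a finite set `B` of vertices there is only a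
mass `ε`. A sample of size `n` is described by its entries in `B`, at a cost of
`n * log₂ (|B| + 1)`, and one bit for each `k`-tuple with an entry outside `B`, of which
`k * ε * n ^ k` are expected. By Gibbs' inequality (`sum_neg_mul_logb_le`), this bounds the entropy,
and as `k ≥ 2`, the entropy is `o(n ^ k)`.

Lower bound: suppose that block `j` has at least `n` elements. With a probability bounded below in
terms of `j` alone, the first half of a sample of size `n` contains a number of distinct vertices of
block `j` of order `n`, and the second half hits block `j + 1` a number of times of order `n`. Given
the first half, each hit has a uniformly random link to the `(k - 1)`-element sets of these
vertices, so that each structure has a conditional probability of at most `2 ^ -m`, where `m` has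
the order `n ^ k` (`BlockSystem.measureReal_comap_eq_inter_le`). Hence the entropy is at least
`κ j * n ^ k` for all `n ≥ t j` that do not exceed the size of block `j`, where `κ j` and `t j` do
not depend on the sizes (`le_sum_neg_mul_logb`, `BlockSystem.exists_forall_le_toReal_entropy`). So
one may first choose an increasing sequence `M` such that `γ n ≤ κ j` and `t j ≤ n` for `n ≥ M j`,
and then take block `j` of size at least `M (j + 1)`: it serves the sample sizes from `M j` to
`M (j + 1)`.
-/

/-! ### Block systems and the Rado hypergraph -/

theorem card_filter_prescribed {T : Type*} [Fintype T] [DecidableEq T] (Q : Finset T)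
    (g : T → Prop) [DecidablePred g]
    [DecidablePred fun f : T → Bool => ∀ t ∈ Q, (f t = true ↔ g t)] :
    (Finset.univ.filter fun f : T → Bool => ∀ t ∈ Q, (f t = true ↔ g t)).card * 2 ^ Q.card =
      2 ^ Fintype.card T := by
  have h : (Finset.univ.filter fun f : T → Bool => ∀ t ∈ Q, (f t = true ↔ g t)) =
      Fintype.piFinset fun t => if t ∈ Q then {decide (g t)} else Finset.univ := by
    ext f
    simp only [Finset.mem_filter, Finset.mem_univ, true_and, Fintype.mem_piFinset]
    refine forall_congr' fun t => ?_
    by_cases ht : t ∈ Q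
    · by_cases hg : g t <;> simp [ht, hg]
    · simp [ht]
  have h2 : ∀ t, (if t ∈ Q then ({decide (g t)} : Finset Bool) else Finset.univ).card =
      if t ∈ Q then 1 else 2 := by
    intro t; split_ifs <;> simp
  rw [h, Fintype.card_piFinset, Finset.prod_congr rfl fun t _ => h2 t]
  have h3 : (2 : ℕ) ^ Q.card = ∏ t, if t ∈ Q then 2 else 1 := by
    rw [Finset.prod_ite_mem, Finset.univ_inter, Finset.prod_const]
  rw [h3, ← Finset.prod_mul_distrib, Finset.prod_congr rfl fun t _ =>
    (show (if t ∈ Q then 1 else 2) * (if t ∈ Q then 2 else 1) = 2 by split_ifs <;> rfl)]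
  simp

/-- A partition of `ℕ` into finite blocks, and for each vertex `v` a set `link v` of finite sets of
vertices, such that within each block all the ways for the link to meet a finite family `Q` of sets
of vertices of lower blocks are equally frequent. The trace of the link on `Q` is prescribed by `g`, and `T` is the
set of vertices of the block that have this trace. -/
structure BlockSystem where
  blk : ℕ → ℕ
  block : ℕ → Finset ℕ
  mem_block : ∀ {j v}, v ∈ block j ↔ blk v = j
  block_nonempty : ∀ j, (block j).Nonempty
  link : ℕ → Finset ℕ → Prop
  equidistributed : ∀ (j : ℕ) (Q : Finset (Finset ℕ)), (∀ F ∈ Q, ∀ u ∈ F, blk u < j) →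
    ∀ g : Finset ℕ → Prop, ∃ T : Finset ℕ,
      (∀ v, v ∈ T ↔ v ∈ block j ∧ ∀ F ∈ Q, (link v F ↔ g F)) ∧
      T.card * 2 ^ Q.card = (block j).card

namespace BlockSystem

open Classical in
/-- The sizes of the blocks may be as large as desired. In the construction, a vertex of block `j`
is an arbitrary pair of a set of sets of lower vertices, which is its link, and one of `N j + 1`
labels. -/
theorem exists_le_card (N : ℕ → ℕ) : ∃ S : BlockSystem, ∀ j, N j ≤ (S.block j).card := by
  -- `s j` is the number of vertices below block `j`, and `c j` the size of block `j`.
  let s : ℕ → ℕ := fun j => Nat.rec 0 (fun j s => s + 2 ^ 2 ^ s * (N j + 1)) j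
  let c : ℕ → ℕ := fun j => 2 ^ 2 ^ s j * (N j + 1)
  have hs : ∀ j, s (j + 1) = s j + c j := fun j => rfl
  have hc : ∀ j, 0 < c j := fun j => by positivity
  have hinf : Infinite (Σ j, Fin (c j)) :=
    Infinite.of_injective (fun j => (⟨j, ⟨0, hc j⟩⟩ : Σ j, Fin (c j)))
      fun a b h => congrArg Sigma.fst h
  obtain ⟨hden⟩ := nonempty_denumerable (Σ j, Fin (c j))
  let e : ℕ ≃ Σ j, Fin (c j) := (Denumerable.eqv _).symm
  let emb : ∀ j, Fin (c j) ↪ ℕ := fun j =>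
    ⟨fun x => e.symm ⟨j, x⟩, fun x y h => by simpa using h⟩
  have he : ∀ j x, e (emb j x) = ⟨j, x⟩ := fun j x => e.apply_symm_apply _
  let block : ℕ → Finset ℕ := fun j => Finset.univ.map (emb j)
  have hblock : ∀ {j v}, v ∈ block j ↔ (e v).1 = j := by
    intro j v
    simp only [block, Finset.mem_map, Finset.mem_univ, true_and]
    constructor
    · rintro ⟨x, rfl⟩; rw [he]
    · intro h; subst h; exact ⟨(e v).2, e.symm_apply_apply v⟩
  have hcard : ∀ j, (block j).card = c j := fun j => by simp [block]
  let below : ℕ → Finset ℕ := fun j => (Finset.range j).biUnion block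
  have hbelow : ∀ {j u}, u ∈ below j ↔ (e u).1 < j := by
    intro j u; simp [below, hblock]
  have hbc : ∀ j, (below j).card = s j := by
    intro j
    have h : (below j).card = ∑ i ∈ Finset.range j, (block i).card := by
      refine Finset.card_biUnion fun a _ b _ hab => Finset.disjoint_left.2 fun v ha hb => hab ?_
      rw [← hblock.1 ha, ← hblock.1 hb]
    rw [h]
    induction j with
    | zero => rfl
    | succ j ih =>
      rw [Finset.sum_range_succ, hs, hcard]
      congr 1
      apply ih
      refine Finset.card_biUnion fun a _ b _ hab => Finset.disjoint_left.2 fun v ha hb => hab ?_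
      rw [← hblock.1 ha, ← hblock.1 hb]
  have hE : ∀ j, Nonempty (Fin (c j) ≃ (↥(below j).powerset → Bool) × Fin (N j + 1)) := by
    intro j
    refine ⟨Fintype.equivOfCardEq ?_⟩
    rw [Fintype.card_prod, Fintype.card_fun, Fintype.card_coe, Finset.card_powerset, hbc]
    simp [c]
  let E := fun j => (hE j).some
  let L : (Σ j, Fin (c j)) → Finset ℕ → Prop := fun x F =>
    ∃ h : F ∈ (below x.1).powerset, (E x.1 x.2).1 ⟨F, h⟩ = true
  refine ⟨⟨fun v => (e v).1, block, hblock, fun j => Finset.card_pos.1 (by rw [hcard]; exact hc j),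
    fun v => L (e v), ?_⟩, fun j => ?_⟩
  · intro j Q hQ g
    have hQ' : ∀ F ∈ Q, F ∈ (below j).powerset := fun F hF =>
      Finset.mem_powerset.2 fun u hu => hbelow.2 (hQ F hF u hu)
    let Q' : Finset ↥(below j).powerset := Finset.univ.filter fun F => F.1 ∈ Q
    have hQc : Q'.card = Q.card := by
      refine Finset.card_bij (fun F _ => F.1) (fun F hF => by simpa [Q'] using hF)
        (fun _ _ _ _ h => Subtype.ext h) fun F hF => ⟨⟨F, hQ' F hF⟩, by simp [Q', hF], rfl⟩
    have h1 : ((block j).filter fun v => ∀ F ∈ Q, (L (e v) F ↔ g F)).card =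
        ((Finset.univ.filter fun f : ↥(below j).powerset → Bool =>
          ∀ t ∈ Q', (f t = true ↔ g t.1)) ×ˢ (Finset.univ : Finset (Fin (N j + 1)))).card := by
      symm
      refine Finset.card_bij (fun y _ => emb j ((E j).symm y)) ?_ ?_ ?_
      · intro y hy
        simp only [Finset.mem_product, Finset.mem_filter, Finset.mem_univ, true_and, and_true]
          at hy
        simp only [Finset.mem_filter]
        refine ⟨by simp [block], fun F hF => ?_⟩
        have := hy ⟨F, hQ' F hF⟩ (by simp [Q', hF])
        rw [← this]
        rw [he]
        simp only [L, Equiv.apply_symm_apply]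
        exact ⟨fun ⟨_, h⟩ => h, fun h => ⟨hQ' F hF, h⟩⟩
      · intro y _ z _ h
        simpa using h
      · intro v hv
        obtain ⟨hv1, hv2⟩ := Finset.mem_filter.1 hv
        obtain ⟨x, -, rfl⟩ := Finset.mem_map.1 hv1
        refine ⟨E j x, ?_, by simp⟩
        simp only [Finset.mem_product, Finset.mem_filter, Finset.mem_univ, true_and, and_true]
        intro t ht
        rw [← hv2 t.1 (by simpa [Q'] using ht)]
        rw [he]
        exact ⟨fun h => ⟨t.2, h⟩, fun ⟨_, h⟩ => h⟩
    refine ⟨(block j).filter fun v => ∀ F ∈ Q, (L (e v) F ↔ g F),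
      fun v => Finset.mem_filter, ?_⟩
    rw [h1, Finset.card_product, hcard, mul_right_comm, ← hQc, card_filter_prescribed,
      Fintype.card_coe, Finset.card_powerset, hbc]
    simp [c]
  · show N j ≤ (block j).card
    rw [hcard]
    calc N j ≤ 1 * (N j + 1) := by omega
      _ ≤ c j := Nat.mul_le_mul_right _ Nat.one_le_two_pow

/-- The `k`-uniform hypergraph of a block system: a set is an edge if one of its vertices `v` lies
in a higher block than the others, and these others form a set in `link v`. -/
def graph (S : BlockSystem) (k : ℕ) : Str k ℕ := fun a =>
  Function.Injective a ∧ ∃ i, (∀ i', i' ≠ i → S.blk (a i') < S.blk (a i)) ∧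
    S.link (a i) ((Finset.univ.erase i).image a)

theorem graph_isHypergraph (S : BlockSystem) (k : ℕ) : (S.graph k).IsHypergraph := by
  refine ⟨fun a h => h.1, ?_⟩
  have key : ∀ (s : Equiv.Perm (Fin k)) (a : Fin k → ℕ), S.graph k a → S.graph k (a ∘ s) := by
    rintro s a ⟨ha, i, hi, hl⟩
    refine ⟨ha.comp s.injective, s.symm i, fun i' h => ?_, ?_⟩
    · simpa using hi (s i') fun h' => h (by rw [← h']; simp)
    · have : (Finset.univ.erase (s.symm i)).image (a ∘ s) = (Finset.univ.erase i).image a := by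
        rw [← Finset.image_image, Finset.image_erase s.injective]
        simp
      rw [this]; simpa using hl
  refine fun s a => ⟨key s a, fun h => ?_⟩
  have := key s⁻¹ _ h
  rwa [Function.comp_assoc, ← Equiv.Perm.coe_mul, mul_inv_cancel, Equiv.Perm.coe_one,
    Function.comp_id] at this

/-- The edges whose top vertex is `v`: `link v` describes them, whichever way they are listed. -/
theorem graph_iff_link (S : BlockSystem) {k : ℕ} {a : Fin k → ℕ} {i : Fin k}
    (ha : Function.Injective a) (hi : ∀ i', i' ≠ i → S.blk (a i') < S.blk (a i)) :
    S.graph k a ↔ S.link (a i) ((Finset.univ.erase i).image a) := by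
  refine ⟨?_, fun h => ⟨ha, i, hi, h⟩⟩
  rintro ⟨-, i', hi', hl⟩
  obtain rfl : i' = i := by
    by_contra h
    exact lt_asymm (hi i' h) (hi' i (Ne.symm h))
  exact hl

end BlockSystem

/-- A hypergraph does not distinguish injective tuples with the same set of entries. -/
theorem Str.IsHypergraph.iff_of_range_eq {k : ℕ} {V : Type*} {M : Str k V} (hM : M.IsHypergraph)
    {a b : Fin k → V} (ha : Function.Injective a) (hb : Function.Injective b)
    (h : Set.range a = Set.range b) : M a ↔ M b := by
  let s : Equiv.Perm (Fin k) := (Equiv.ofInjective a ha).trans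
    ((Equiv.setCongr h).trans (Equiv.ofInjective b hb).symm)
  have : a = b ∘ s := by
    funext i
    exact (congrArg Subtype.val ((Equiv.ofInjective b hb).apply_symm_apply
      (Equiv.setCongr h (Equiv.ofInjective a ha i)))).symm
  rw [this]
  exact (hM.2 s b).symm

open Classical in
/-- A required extension of a finite set `D` of vertices is realized in every block above `D`. -/
theorem BlockSystem.graph_isRado (S : BlockSystem) (k : ℕ) : (S.graph k).IsRado := by
  refine ⟨S.graph_isHypergraph k, fun D N hN hD => ?_⟩
  let j := D.sup S.blk + 1
  have hDj : ∀ d ∈ D, S.blk d < j := fun d hd => Nat.lt_succ_of_le (Finset.le_sup hd)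
  -- `g F` says that `F`, together with the new vertex, is to be an edge.
  let g : Finset ℕ → Prop := fun F => ∃ b : Fin k → Option D, N b ∧
    Set.range b = insert none {x | ∃ d : D, x = some d ∧ (d : ℕ) ∈ F}
  obtain ⟨T, hT, hcount⟩ := S.equidistributed j D.powerset
    (fun F hF u hu => hDj u (Finset.mem_powerset.1 hF hu)) g
  have hne : T.Nonempty := by
    refine Finset.card_pos.1 (Nat.pos_of_ne_zero fun h0 => ?_)
    rw [h0, zero_mul] at hcount
    exact (Finset.card_pos.2 (S.block_nonempty j)).ne hcount
  obtain ⟨v, hv⟩ := hne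
  obtain ⟨hvj, hv⟩ := (hT v).1 hv
  rw [S.mem_block] at hvj
  have hvD : v ∉ D := fun h => (hDj v h).ne hvj
  refine ⟨v, hvD, fun a => ?_⟩
  let f : Option D → ℕ := fun x => x.elim v fun d => (d : ℕ)
  have hf : Function.Injective f := by
    rintro (_ | x) (_ | y) h
    · rfl
    · exact absurd (show v ∈ D from (show v = y from h) ▸ y.2) hvD
    · exact absurd (show v ∈ D from (show (x : ℕ) = v from h) ▸ x.2) hvD
    · exact congrArg some (Subtype.ext h)
  show N a ↔ S.graph k (f ∘ a)
  by_cases ha : Function.Injective a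
  swap
  · exact ⟨fun h => absurd (hN.1 a h) ha, fun h => absurd (h.1.of_comp) ha⟩
  by_cases hnone : ∃ i, a i = none
  · obtain ⟨i, hi⟩ := hnone
    have hother : ∀ i', i' ≠ i → ∃ d : D, a i' = some d := by
      intro i' h
      cases h' : a i' with
      | none => exact absurd (ha (h'.trans hi.symm)) h
      | some d => exact ⟨d, rfl⟩
    have hfi : (f ∘ a) i = v := by simp [f, hi]
    rw [S.graph_iff_link (i := i) (hf.comp ha), hfi]
    · have hsub : (Finset.univ.erase i).image (f ∘ a) ∈ D.powerset := by
        rw [Finset.mem_powerset]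
        intro u hu
        obtain ⟨i', h, rfl⟩ := Finset.mem_image.1 hu
        obtain ⟨d, hd⟩ := hother i' (Finset.ne_of_mem_erase h)
        simp [f, hd]
      rw [hv _ hsub]
      have hrange : Set.range a = insert none
          {x | ∃ d : D, x = some d ∧ (d : ℕ) ∈ (Finset.univ.erase i).image (f ∘ a)} := by
        ext x
        simp only [Set.mem_range, Set.mem_insert_iff, Set.mem_ofPred_eq, Finset.mem_image,
          Finset.mem_erase, Finset.mem_univ, and_true]
        constructor
        · rintro ⟨i', rfl⟩
          by_cases h : i' = i
          · exact Or.inl (h ▸ hi)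
          · obtain ⟨d, hd⟩ := hother i' h
            exact Or.inr ⟨d, hd, i', h, by simp [f, hd]⟩
        · rintro (rfl | ⟨d, rfl, i', h, h'⟩)
          · exact ⟨i, hi⟩
          · exact ⟨i', hf h'⟩
      constructor
      · exact fun h => ⟨a, h, hrange⟩
      · rintro ⟨b, hb, hbr⟩
        exact (hN.iff_of_range_eq ha (hN.1 b hb) (hrange.trans hbr.symm)).2 hb
    · intro i' h
      obtain ⟨d, hd⟩ := hother i' h
      rw [hfi, hvj]
      simpa [f, hd] using hDj d d.2
  · have h : ∀ i, ∃ d : D, a i = some d := by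
      intro i
      cases h' : a i with
      | none => exact absurd ⟨i, h'⟩ hnone
      | some d => exact ⟨d, rfl⟩
    choose a' ha' using h
    obtain rfl : a = fun i => some (a' i) := funext ha'
    exact hD a'

/-! ### The measure of a block system -/

namespace BlockSystem

/-- The probability measure on the vertices that gives block `j` the weight `2 ^ -(j + 1)`, spread
evenly over the block. -/
noncomputable def measure (S : BlockSystem) : Measure ℕ :=
  Measure.sum fun j => (2⁻¹ : ℝ≥0∞) ^ (j + 1) • uniformOn (S.block j : Set ℕ)

instance (S : BlockSystem) (j : ℕ) : IsProbabilityMeasure (uniformOn (S.block j : Set ℕ)) :=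
  isProbabilityMeasure_uniformOn (S.block j).finite_toSet (S.block_nonempty j)

instance (S : BlockSystem) : IsProbabilityMeasure S.measure := by
  constructor
  rw [measure, Measure.sum_apply _ MeasurableSet.univ]
  simp only [Measure.smul_apply, measure_univ, smul_eq_mul, mul_one]
  rw [ENNReal.tsum_geometric_add_one, ENNReal.one_sub_inv_two, inv_inv]
  exact ENNReal.inv_mul_cancel (by simp) (by simp)

theorem measureReal_of_subset (S : BlockSystem) {j : ℕ} {T : Finset ℕ} (hT : T ⊆ S.block j) :
    S.measure.real T = 2⁻¹ ^ (j + 1) * (T.card / (S.block j).card) := by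
  have h : S.measure (T : Set ℕ) = 2⁻¹ ^ (j + 1) * (T.card / (S.block j).card : ℝ≥0∞) := by
    rw [measure, Measure.sum_apply _ (Set.toFinite _).measurableSet, tsum_eq_single j]
    · rw [Measure.smul_apply, smul_eq_mul, uniformOn, cond_apply (Set.toFinite _).measurableSet,
        Set.inter_eq_self_of_subset_right (by exact_mod_cast hT), Measure.count_apply_finset,
        Measure.count_apply_finset, ENNReal.div_eq_inv_mul]
    · intro i hi
      rw [Measure.smul_apply, smul_eq_mul, uniformOn_eq_zero_iff (S.block i).finite_toSet |>.2,
        mul_zero]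
      rw [← Finset.coe_inter, Finset.coe_eq_empty, ← Finset.disjoint_iff_inter_eq_empty]
      refine Finset.disjoint_left.2 fun v h1 h2 => hi ?_
      rw [← S.mem_block.1 h1, ← S.mem_block.1 (hT h2)]
  rw [Measure.real, h]
  simp

theorem measure_singleton_pos (S : BlockSystem) (v : ℕ) : 0 < S.measure {v} := by
  have h := S.measureReal_of_subset (j := S.blk v) (T := {v}) (by simp [S.mem_block])
  have hc : (0 : ℝ) < (S.block (S.blk v)).card := by
    exact_mod_cast Finset.card_pos.2 (S.block_nonempty _)
  have : 0 < S.measure.real {v} := by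
    rw [Finset.coe_singleton] at h
    rw [h]; simp only [Finset.card_singleton]; positivity
  exact (ENNReal.toReal_pos_iff.1 this).1

theorem measureReal_block (S : BlockSystem) (j : ℕ) :
    S.measure.real (S.block j) = 2⁻¹ ^ (j + 1) := by
  have hc : ((S.block j).card : ℝ) ≠ 0 := by
    exact_mod_cast (Finset.card_pos.2 (S.block_nonempty _)).ne'
  rw [S.measureReal_of_subset subset_rfl, div_self hc, mul_one]

end BlockSystem

/-! ### Blow ups and the law of their random structures -/

/-- The structure induced on `ι` by a map `v` from `ι` to the underlying set of `R`. -/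
def Str.comap {k : ℕ} {ι V : Type*} (R : Str k V) (v : ι → V) : Str k ι := fun a => R (v ∘ a)

theorem Str.IsHypergraph.comp_iff {k : ℕ} {V : Type*} {R : Str k V} (hR : R.IsHypergraph)
    {f : Fin k → Fin k} (hf : Function.Injective f) (a : Fin k → V) : R (a ∘ f) ↔ R a :=
  (hR.2 (Equiv.ofBijective f (Finite.injective_iff_bijective.1 hf)) a).symm

theorem QfType.act_top {k : ℕ} (s : Equiv.Perm (Fin k)) : QfType.act s (.top k) = .top k := by
  ext f
  exact s⁻¹.injective.of_comp_iff f

theorem QfType.act_bot {k : ℕ} (s : Equiv.Perm (Fin k)) : QfType.act s (.bot k) = .bot k := rfl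

theorem QfType.act_injective {k : ℕ} (s : Equiv.Perm (Fin k)) :
    Function.Injective (QfType.act s) := by
  intro u v h
  ext f
  have := congrFun (congrArg Subtype.val h) (s ∘ f)
  simpa [QfType.act] using this

namespace ExtHypergraphon

variable {k : ℕ}

theorem dirac_image_act {u : QfType k} {s : Equiv.Perm (Fin k)} (hu : QfType.act s u = u)
    (B : Set (QfType k)) :
    Measure.dirac u (QfType.act s '' B) = Measure.dirac u B := by
  have : u ∈ QfType.act s '' B ↔ u ∈ B := by
    conv_lhs => rw [← hu]
    exact (QfType.act_injective s).mem_set_image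
  rw [Measure.dirac_apply, Measure.dirac_apply]
  by_cases h : u ∈ B
  · rw [Set.indicator_of_mem h, Set.indicator_of_mem (this.2 h)]
  · rw [Set.indicator_of_notMem h, Set.indicator_of_notMem (mt this.1 h)]

/-- The vertices of the hypergraph being blown up that are determined by the coordinates at the
singletons. -/
def vertices (hk : 2 ≤ k) (π : unitInterval → ℕ) (x : SubsetsLT k (Fin k) → unitInterval) :
    Fin k → ℕ :=
  fun i => π (x ⟨{i}, by rw [Finset.card_singleton]; exact hk⟩)

theorem measurableSet_vertices (hk : 2 ≤ k) {π : unitInterval → ℕ} (hπ : Measurable π)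
    (R : Str k ℕ) : MeasurableSet {x | R (vertices hk π x)} := by
  have : Measurable (vertices hk π) :=
    measurable_pi_lambda _ fun i => hπ.comp (measurable_pi_apply _)
  exact this (Set.to_countable {a | R a}).measurableSet

open Classical in
/-- The `π`-blow up of a hypergraph `R`. -/
noncomputable def blowUp (hk : 2 ≤ k) {π : unitInterval → ℕ} (hπ : Measurable π) {R : Str k ℕ}
    (hR : R.IsHypergraph) : ExtHypergraphon k where
  kernel := Kernel.piecewise (measurableSet_vertices hk hπ R)
    (Kernel.const _ (Measure.dirac (QfType.top k))) (Kernel.const _ (Measure.dirac (QfType.bot k)))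
  isMarkovKernel := inferInstance
  coherent := by
    intro s x B _
    have h : R (vertices hk π fun F => x (permSubset s F)) ↔ R (vertices hk π x) := by
      have : (vertices hk π fun F => x (permSubset s F)) = vertices hk π x ∘ s := by
        funext i
        simp [vertices, permSubset]
      rw [this, hR.comp_iff s.injective]
    by_cases hx : R (vertices hk π x)
    · have hx' : (fun F => x (permSubset s F)) ∈ {x | R (vertices hk π x)} := h.2 hx
      rw [Kernel.piecewise_apply, Kernel.piecewise_apply, if_pos hx',
        if_pos (show x ∈ {x | R (vertices hk π x)} from hx),
        Kernel.const_apply, Kernel.const_apply, dirac_image_act (QfType.act_top s)]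
    · have hx' : (fun F => x (permSubset s F)) ∉ {x | R (vertices hk π x)} := mt h.1 hx
      rw [Kernel.piecewise_apply, Kernel.piecewise_apply, if_neg hx',
        if_neg (show x ∉ {x | R (vertices hk π x)} from hx),
        Kernel.const_apply, Kernel.const_apply, dirac_image_act (QfType.act_bot s)]

open Classical in
theorem blowUp_isBlowUp (hk : 2 ≤ k) {π : unitInterval → ℕ} (hπ : Measurable π)
    (hpos : ∀ i, 0 < volume (π ⁻¹' {i})) {R : Str k ℕ} (hR : R.IsHypergraph) :
    (blowUp hk hπ hR).IsBlowUp hk π R := by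
  refine ⟨hπ, hpos, fun x => ?_⟩
  rw [blowUp, Kernel.piecewise_apply]
  rfl

theorem IsBlowUp.inducesBorelHypergraph {hk : 2 ≤ k} {W : ExtHypergraphon k}
    {π : unitInterval → ℕ} {R : Str k ℕ} (h : W.IsBlowUp hk π R) : W.InducesBorelHypergraph := by
  refine ⟨ae_of_all _ fun p => ?_, ae_of_all _ fun x => ?_⟩
  · rw [h.2.2, h.2.2]
    simp only [glue, Finset.card_singleton, ↓reduceIte]
    congr
  · rw [h.2.2]
    split_ifs
    · exact Or.inl rfl
    · exact Or.inr rfl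

/-- The randomization of a blow up does not depend on its last argument, up to a null set of values
of this argument. -/
theorem IsBlowUp.randomization_iff {hk : 2 ≤ k} {W : ExtHypergraphon k}
    {π : unitInterval → ℕ} {R : Str k ℕ} (h : W.IsBlowUp hk π R)
    (t : SubsetsLT k (Fin k) → unitInterval) :
    ∀ᵐ ζ : unitInterval, ∀ f, (W.randomization t ζ).1 f ↔
      Function.Injective f ∧ R (vertices hk π t) := by
  have hW := W.exists_randomization.choose_spec
  have hm : Measurable (W.randomization t) := hW.1.comp measurable_prodMk_left
  have hmap : volume.map (W.randomization t) = W.kernel t := hW.2 t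
  have key : ∀ u, W.kernel t = Measure.dirac u → ∀ᵐ ζ : unitInterval, W.randomization t ζ = u := by
    intro u hu
    have : ∀ᵐ y ∂(volume.map (W.randomization t)), y = u := by
      rw [hmap, hu, ae_dirac_iff (Set.toFinite {y | y = u}).measurableSet]
    exact ae_of_ae_map hm.aemeasurable this
  have ht := h.2.2 t
  by_cases hR : R (vertices hk π t)
  · filter_upwards [key (.top k) (ht.trans (if_pos hR))] with ζ hζ f
    rw [hζ]
    exact ⟨fun hf => ⟨hf, hR⟩, fun hf => hf.1⟩
  · filter_upwards [key (.bot k) (ht.trans (if_neg hR))] with ζ hζ f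
    rw [hζ]
    exact ⟨False.elim, fun hf => hR hf.2⟩

/-- The sequence `hat x J` is independent of the coordinate at `J`: it refers to sets with fewer
than `k` elements only. -/
theorem map_hat_prodMk (J : Finset ℕ) (hJ : J.card = k) :
    ∃ ν : Measure (SubsetsLT k (Fin k) → unitInterval), SFinite ν ∧
    (Measure.infinitePi fun _ : SubsetsLE k ℕ => (volume : Measure unitInterval)).map
      (fun x => (hat x J hJ, x ⟨J, hJ.le⟩)) = ν.prod volume := by
  classical
  let P := Measure.infinitePi fun _ : SubsetsLE k ℕ => (volume : Measure unitInterval)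
  let idx : SubsetsLT k (Fin k) → SubsetsLE k ℕ := fun F =>
    ⟨F.1.map (J.orderEmbOfFin hJ).toEmbedding, by simpa using F.2.le⟩
  let A : Finset (SubsetsLE k ℕ) := Finset.univ.image idx
  have hind : iIndepFun (fun (i : SubsetsLE k ℕ) (x : SubsetsLE k ℕ → unitInterval) => x i) P :=
    iIndepFun_infinitePi (X := fun _ x => x) fun _ => measurable_id
  have hA : Disjoint A {⟨J, hJ.le⟩} := by
    rw [Finset.disjoint_singleton_right]
    intro h
    obtain ⟨F, -, hF⟩ := Finset.mem_image.1 h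
    have := congrArg (fun s : SubsetsLE k ℕ => s.1.card) hF
    simp only [idx, Finset.card_map, hJ] at this
    exact F.2.ne this
  have h2 := hind.indepFun_finset A {⟨J, hJ.le⟩} hA fun i => measurable_pi_apply i
  let φ : (A → unitInterval) → SubsetsLT k (Fin k) → unitInterval :=
    fun y F => y ⟨idx F, Finset.mem_image_of_mem _ (Finset.mem_univ F)⟩
  let ψ : (({⟨J, hJ.le⟩} : Finset (SubsetsLE k ℕ)) → unitInterval) → unitInterval :=
    fun y => y ⟨⟨J, hJ.le⟩, Finset.mem_singleton_self _⟩
  have hφ : Measurable φ := measurable_pi_lambda _ fun F => measurable_pi_apply _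
  have hψ : Measurable ψ := measurable_pi_apply _
  have h3 : IndepFun (fun x => hat x J hJ) (fun x => x ⟨J, hJ.le⟩) P := h2.comp hφ hψ
  have hm : Measurable fun x : SubsetsLE k ℕ → unitInterval => hat x J hJ :=
    measurable_pi_lambda _ fun F => measurable_pi_apply _
  refine ⟨P.map fun x => hat x J hJ, inferInstance, ?_⟩
  rw [(indepFun_iff_map_prod_eq_prod_map_map hm.aemeasurable
    (measurable_pi_apply _).aemeasurable).1 h3]
  congr 1
  exact Measure.infinitePi_map_eval _ _

/-- Almost surely the null sets of `randomization_iff` are avoided at all `J` at once. -/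
theorem IsBlowUp.ae_toStr {hk : 2 ≤ k} {W : ExtHypergraphon k}
    {π : unitInterval → ℕ} {R : Str k ℕ} (h : W.IsBlowUp hk π R) (hR : R.IsHypergraph) :
    ∀ᵐ x ∂(Measure.infinitePi fun _ : SubsetsLE k ℕ => (volume : Measure unitInterval)),
      W.toStr x = R.comap fun v =>
        π (x ⟨{v}, by rw [Finset.card_singleton]; omega⟩) := by
  have hrand : ∀ᵐ x ∂(Measure.infinitePi fun _ : SubsetsLE k ℕ => (volume : Measure unitInterval)),
      ∀ (J : Finset ℕ) (hJ : J.card = k), ∀ f, (W.randomization (hat x J hJ) (x ⟨J, hJ.le⟩)).1 f ↔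
        Function.Injective f ∧ R (vertices hk π (hat x J hJ)) := by
    rw [ae_all_iff]
    intro J
    by_cases hJ : J.card = k
    swap
    · exact ae_of_all _ fun x hJ' => absurd hJ' hJ
    simp only [hJ, forall_true_left]
    obtain ⟨ν, hν, hmap⟩ := map_hat_prodMk J hJ
    have hms : MeasurableSet {y : (SubsetsLT k (Fin k) → unitInterval) × unitInterval |
        ∀ f, (W.randomization y.1 y.2).1 f ↔ Function.Injective f ∧ R (vertices hk π y.1)} := by
      have hW := W.exists_randomization.choose_spec.1
      rw [Set.ofPred_forall]
      refine MeasurableSet.iInter fun f => ?_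
      have h1 : MeasurableSet {y : (SubsetsLT k (Fin k) → unitInterval) × unitInterval |
          (W.randomization y.1 y.2).1 f} :=
        hW (Set.toFinite {u : QfType k | u.1 f}).measurableSet
      have h2 : MeasurableSet {y : (SubsetsLT k (Fin k) → unitInterval) × unitInterval |
          Function.Injective f ∧ R (vertices hk π y.1)} :=
        (MeasurableSet.const _).inter (measurable_fst (measurableSet_vertices hk h.1 R))
      exact h1.iff h2
    have hae : ∀ᵐ y ∂(ν.prod volume), ∀ f, (W.randomization y.1 y.2).1 f ↔
        Function.Injective f ∧ R (vertices hk π y.1) := by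
      rw [Measure.ae_prod_iff_ae_ae hms]
      exact ae_of_all _ fun t => h.randomization_iff t
    rw [← hmap] at hae
    refine ae_of_ae_map ?_ hae
    exact ((measurable_pi_lambda _ fun F => measurable_pi_apply _).prodMk
      (measurable_pi_apply _)).aemeasurable
  filter_upwards [hrand] with x hx
  funext a
  refine propext ?_
  let p : ℕ → ℕ := fun v => π (x ⟨{v}, by rw [Finset.card_singleton]; omega⟩)
  have hv : ∀ (J : Finset ℕ) (hJ : J.card = k),
      vertices hk π (hat x J hJ) = p ∘ J.orderEmbOfFin hJ := by
    intro J hJ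
    funext i
    simp [vertices, hat, p]
  show (∃ (J : Finset ℕ) (hJ : J.card = k) (f : Fin k → Fin k),
    (∀ i, a i = J.orderEmbOfFin hJ (f i)) ∧
      (W.randomization (hat x J hJ) (x ⟨J, hJ.le⟩)).1 f) ↔ R (p ∘ a)
  constructor
  · rintro ⟨J, hJ, f, hf, hr⟩
    obtain ⟨hinj, hr⟩ := (hx J hJ f).1 hr
    obtain rfl : a = J.orderEmbOfFin hJ ∘ f := funext hf
    rw [hv] at hr
    exact (hR.comp_iff hinj _).2 hr
  · intro hr
    have ha : Function.Injective a := (hR.1 _ hr).of_comp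
    let J := Finset.univ.image a
    have hJ : J.card = k := by
      rw [Finset.card_image_of_injective _ ha, Finset.card_univ, Fintype.card_fin]
    have hmem : ∀ i, ∃ j, J.orderEmbOfFin hJ j = a i := by
      intro i
      have : a i ∈ (J : Set ℕ) := Finset.mem_coe.2 (Finset.mem_image_of_mem _ (Finset.mem_univ i))
      rwa [← Finset.range_orderEmbOfFin J hJ] at this
    choose f hf using hmem
    have hfi : Function.Injective f := fun i i' e => ha (by rw [← hf, ← hf, e])
    refine ⟨J, hJ, f, fun i => (hf i).symm, (hx J hJ f).2 ⟨hfi, ?_⟩⟩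
    rw [hv, ← hR.comp_iff hfi]
    have : a = J.orderEmbOfFin hJ ∘ f := funext fun i => (hf i).symm
    rwa [this] at hr

/-- The random structure of a blow up of `R` is obtained by choosing a vertex of `R` independently
for each element. -/
theorem IsBlowUp.map_restrict_law {hk : 2 ≤ k} {W : ExtHypergraphon k}
    {π : unitInterval → ℕ} {R : Str k ℕ} (h : W.IsBlowUp hk π R) (hR : R.IsHypergraph) (n : ℕ) :
    W.law.map (Str.restrict n) =
      (Measure.pi fun _ : Fin n => (volume : Measure unitInterval).map π).map R.comap := by
  have hπ := h.1
  have hp : ∀ v : ℕ, ({v} : Finset ℕ).card ≤ k := fun v => by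
    rw [Finset.card_singleton]; omega
  have hcomap : ∀ {ι : Type} [Countable ι], Measurable fun v : ι → ℕ => R.comap v := by
    intro ι _
    refine measurable_pi_lambda _ fun a => ?_
    have : Measurable fun v : ι → ℕ => v ∘ a :=
      measurable_pi_lambda _ fun i => measurable_pi_apply _
    exact (measurable_of_countable R).comp this
  have hev : Measurable fun (x : SubsetsLE k ℕ → unitInterval) (v : ℕ) => π (x ⟨{v}, hp v⟩) :=
    measurable_pi_lambda _ fun v => hπ.comp (measurable_pi_apply _)
  have hrestrict : Measurable (Str.restrict (k := k) n) :=
    measurable_pi_lambda _ fun a => measurable_pi_apply _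
  have hcv : Measurable fun x : SubsetsLE k ℕ → unitInterval =>
      R.comap fun v => π (x ⟨{v}, hp v⟩) := hcomap.comp hev
  rw [law, Measure.map_congr (h.ae_toStr hR), Measure.map_map hrestrict hcv]
  have hinj : Function.Injective fun i : Fin n => (⟨{(i : ℕ)}, hp i⟩ : SubsetsLE k ℕ) := by
    intro i i' e
    have := congrArg Subtype.val e
    exact Fin.ext (Finset.singleton_injective this)
  have h1 := Measure.map_infinitePi_infinitePi_of_inj
    (P := fun _ : SubsetsLE k ℕ => (volume : Measure unitInterval)) hinj
  rw [Measure.infinitePi_eq_pi (μ := fun _ : Fin n => (volume : Measure unitInterval))] at h1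
  rw [← Measure.pi_map_pi (μ := fun _ : Fin n => (volume : Measure unitInterval))
    (f := fun _ => π) fun _ => hπ.aemeasurable, ← h1, Measure.map_map, Measure.map_map]
  · rfl
  · exact hcomap.comp (measurable_pi_lambda _ fun i => hπ.comp (measurable_pi_apply _))
  · exact measurable_pi_lambda _ fun i => measurable_pi_apply _
  · exact hcomap
  · exact measurable_pi_lambda _ fun i => hπ.comp (measurable_pi_apply _)

end ExtHypergraphon

/-! ### Entropy of distributions on finite sets -/

theorem neg_mul_logb_nonneg {x : ℝ} (h0 : 0 ≤ x) (h1 : x ≤ 1) : 0 ≤ -(x * Real.logb 2 x) := by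
  have : Real.logb 2 x ≤ 0 := Real.logb_nonpos one_lt_two h0 h1
  nlinarith

theorem entropy_eq_ofReal_sum {S : Type*} [Fintype S] [MeasurableSpace S]
    [MeasurableSingletonClass S] (ν : Measure S) [IsProbabilityMeasure ν] :
    entropy ν = ENNReal.ofReal (∑ s, -(ν.real {s} * Real.logb 2 (ν.real {s}))) := by
  classical
  have h1 : ν {s | 0 < ν {s}} = 1 := by
    rw [← prob_compl_eq_zero_iff (Set.toFinite _).measurableSet,
      ← Set.biUnion_of_singleton {s | 0 < ν {s}}ᶜ, measure_biUnion_null_iff (Set.to_countable _)]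
    exact fun s hs => nonpos_iff_eq_zero.1 (not_lt.1 hs)
  have hnn : ∀ s : S, 0 ≤ -(ν.real {s} * Real.logb 2 (ν.real {s})) := fun s =>
    neg_mul_logb_nonneg measureReal_nonneg measureReal_le_one
  rw [entropy, if_pos h1, ENNReal.ofReal_sum_of_nonneg fun s _ => hnn s]
  refine (tsum_subtype {s : S | 0 < ν {s}}
    fun s => ENNReal.ofReal (-(ν.real {s} * Real.logb 2 (ν.real {s})))).trans ?_
  rw [tsum_fintype]
  refine Finset.sum_congr rfl fun s _ => ?_
  by_cases hs : 0 < ν {s}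
  · exact Set.indicator_of_mem (s := {s : S | 0 < ν {s}}) hs _
  · rw [Set.indicator_of_notMem (s := {s : S | 0 < ν {s}}) hs]
    have : ν.real {s} = 0 := by
      rw [Measure.real, nonpos_iff_eq_zero.1 (not_lt.1 hs), ENNReal.toReal_zero]
    simp [this]

theorem toReal_entropy {S : Type*} [Fintype S] [MeasurableSpace S]
    [MeasurableSingletonClass S] (ν : Measure S) [IsProbabilityMeasure ν] :
    (entropy ν).toReal = ∑ s, -(ν.real {s} * Real.logb 2 (ν.real {s})) := by
  rw [entropy_eq_ofReal_sum, ENNReal.toReal_ofReal]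
  exact Finset.sum_nonneg fun s _ => neg_mul_logb_nonneg measureReal_nonneg measureReal_le_one

/-- Gibbs' inequality: a code adapted to another distribution `q` is not shorter on average. -/
theorem sum_neg_mul_logb_le {S : Type*} [Fintype S] {p q : S → ℝ} (hp : ∀ s, 0 ≤ p s)
    (hq : ∀ s, 0 ≤ q s) (hpq : ∀ s, 0 < p s → 0 < q s) (hp1 : ∑ s, p s = 1)
    (hq1 : ∑ s, q s ≤ 1) :
    ∑ s, -(p s * Real.logb 2 (p s)) ≤ ∑ s, p s * -Real.logb 2 (q s) := by
  have hl : 0 < Real.log 2 := Real.log_pos one_lt_two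
  have h : ∀ s, -(p s * Real.logb 2 (p s)) - p s * -Real.logb 2 (q s) ≤
      (q s - p s) / Real.log 2 := by
    intro s
    rcases (hp s).eq_or_lt with h0 | h0
    · rw [← h0]; simpa using div_nonneg (hq s) hl.le
    · have h1 := Real.log_le_sub_one_of_pos (div_pos (hpq s h0) h0)
      rw [Real.log_div (hpq s h0).ne' h0.ne'] at h1
      have h2 : p s * (Real.log (q s) - Real.log (p s)) ≤ q s - p s := by
        calc _ ≤ p s * (q s / p s - 1) := mul_le_mul_of_nonneg_left h1 h0.le
          _ = q s - p s := by field_simp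
      calc _ = p s * (Real.log (q s) - Real.log (p s)) / Real.log 2 := by
            simp only [Real.logb]; ring
        _ ≤ _ := div_le_div_of_nonneg_right h2 hl.le
  have h3 := Finset.sum_le_sum fun s (_ : s ∈ Finset.univ) => h s
  rw [Finset.sum_sub_distrib, ← Finset.sum_div, Finset.sum_sub_distrib, hp1] at h3
  have h4 : (∑ s, q s - 1) / Real.log 2 ≤ 0 := div_nonpos_of_nonpos_of_nonneg (by linarith) hl.le
  linarith

/-- If a part `r` of total mass at least `c` of a distribution `p` is spread out, in the sense that
its atoms are at most `2 ^ -m`, then the entropy of `p` is at least about `c * m / 2`. -/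
theorem le_sum_neg_mul_logb {S : Type*} [Fintype S] {p r : S → ℝ} {c m : ℝ} (hc : 0 < c)
    (hr0 : ∀ s, 0 ≤ r s) (hrp : ∀ s, r s ≤ p s) (hrm : ∀ s, r s ≤ 2 ^ (-m))
    (hp1 : ∑ s, p s = 1) (hr : c ≤ ∑ s, r s) :
    c / 2 * (m - Real.logb 2 (2 / c)) ≤ ∑ s, -(p s * Real.logb 2 (p s)) := by
  classical
  have hp : ∀ s, 0 ≤ p s := fun s => (hr0 s).trans (hrp s)
  have hp1' : ∀ s, p s ≤ 1 := fun s =>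
    hp1 ▸ Finset.single_le_sum (fun s _ => hp s) (Finset.mem_univ s)
  have hnn : ∀ s, 0 ≤ -(p s * Real.logb 2 (p s)) := fun s => neg_mul_logb_nonneg (hp s) (hp1' s)
  have hδ : (0 : ℝ) < 2 ^ (-m) := Real.rpow_pos_of_pos two_pos _
  rcases le_total (m - Real.logb 2 (2 / c)) 0 with hm | hm
  · exact (mul_nonpos_of_nonneg_of_nonpos (by positivity) hm).trans
      (Finset.sum_nonneg fun s _ => hnn s)
  -- The atoms of `p` that are larger than `2 / c * 2 ^ -m` are too few to carry half of `r`.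
  let T : Finset S := Finset.univ.filter fun s => p s ≤ 2 / c * 2 ^ (-m)
  have hTc : ∑ s ∈ Tᶜ, r s ≤ c / 2 := by
    have h1 : ∑ s ∈ Tᶜ, r s ≤ Tᶜ.card * 2 ^ (-m) := by
      simpa using Finset.sum_le_card_nsmul Tᶜ r _ fun s _ => hrm s
    have h2 : Tᶜ.card * (2 / c * 2 ^ (-m)) ≤ ∑ s ∈ Tᶜ, p s := by
      have := Finset.card_nsmul_le_sum Tᶜ p (2 / c * 2 ^ (-m)) fun s hs => by
        simpa [T] using (le_of_lt (by simpa [T] using hs))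
      simpa using this
    have h3 : ∑ s ∈ Tᶜ, p s ≤ 1 :=
      hp1 ▸ Finset.sum_le_univ_sum_of_nonneg hp
    have h4 : (Tᶜ.card * 2 ^ (-m)) * (2 / c) ≤ 1 := by
      calc _ = Tᶜ.card * (2 / c * 2 ^ (-m)) := by ring
        _ ≤ 1 := h2.trans h3
    have h5 : (Tᶜ.card * (2 : ℝ) ^ (-m)) ≤ c / 2 := by
      rw [← le_div_iff₀ (by positivity)] at h4
      simpa using h4
    exact h1.trans h5
  have hT : c / 2 ≤ ∑ s ∈ T, p s := by
    have := Finset.sum_add_sum_compl T r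
    have h2 := Finset.sum_le_sum fun s (_ : s ∈ T) => hrp s
    linarith
  calc c / 2 * (m - Real.logb 2 (2 / c))
      ≤ (∑ s ∈ T, p s) * (m - Real.logb 2 (2 / c)) := mul_le_mul_of_nonneg_right hT hm
    _ = ∑ s ∈ T, p s * (m - Real.logb 2 (2 / c)) := Finset.sum_mul ..
    _ ≤ ∑ s ∈ T, -(p s * Real.logb 2 (p s)) := by
        refine Finset.sum_le_sum fun s hs => ?_
        rcases (hp s).eq_or_lt with h0 | h0
        · simp [← h0]
        · have h1 : p s ≤ 2 / c * 2 ^ (-m) := by simpa [T] using hs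
          have h2 := Real.logb_le_logb_of_le one_lt_two h0 h1
          rw [Real.logb_mul (by positivity) hδ.ne', Real.logb_rpow two_pos (by norm_num)] at h2
          rw [← mul_neg]
          exact mul_le_mul_of_nonneg_left (by linarith) h0.le
    _ ≤ ∑ s, -(p s * Real.logb 2 (p s)) := Finset.sum_le_univ_sum_of_nonneg hnn

/-! ### Samples of a countable structure have entropy `o(n ^ k)` -/

namespace Str

variable {k : ℕ}

/-- The distribution of the structure induced by `R` on `n` independent vertices chosen
according to `μ`. -/
noncomputable def sampleLaw (R : Str k ℕ) (μ : Measure ℕ) (n : ℕ) : Measure (Str k (Fin n)) :=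
  (Measure.pi fun _ : Fin n => μ).map R.comap

theorem measurable_comap (R : Str k ℕ) (n : ℕ) :
    Measurable (R.comap : (Fin n → ℕ) → Str k (Fin n)) := measurable_of_countable _

instance (R : Str k ℕ) (μ : Measure ℕ) [IsProbabilityMeasure μ] (n : ℕ) :
    IsProbabilityMeasure (R.sampleLaw μ n) :=
  Measure.isProbabilityMeasure_map (measurable_comap R n).aemeasurable

open Classical in
/-- Record the vertices that lie in `B`, and mark the others by `none`. -/
noncomputable def trunc (B : Finset ℕ) {n : ℕ} (v : Fin n → ℕ) : Fin n → Option B :=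
  fun i => if h : v i ∈ B then some ⟨v i, h⟩ else none

theorem trunc_eq_none {B : Finset ℕ} {n : ℕ} {v : Fin n → ℕ} {i : Fin n} :
    trunc B v i = none ↔ v i ∉ B := by
  by_cases h : v i ∈ B <;> simp [trunc, h]

theorem eq_of_trunc_eq {B : Finset ℕ} {n : ℕ} {v v' : Fin n → ℕ} (h : trunc B v = trunc B v')
    {i : Fin n} (hi : trunc B v i ≠ none) : v i = v' i := by
  have h1 : v i ∈ B := by by_contra h'; exact hi (trunc_eq_none.2 h')
  have h2 : v' i ∈ B := by by_contra h'; exact hi (h ▸ trunc_eq_none.2 h')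
  have := congrFun h i
  simpa [trunc, h1, h2] using this

open Classical in
/-- The number of `k`-tuples with an entry marked by `none`. -/
noncomputable def freeCard (k : ℕ) {B : Finset ℕ} {n : ℕ} (t : Fin n → Option B) : ℕ :=
  (Finset.univ.filter fun a : Fin k → Fin n => ∃ i, t (a i) = none).card

open Classical in
/-- Given the vertices that lie in `B`, only the tuples with a vertex outside `B` are free. -/
theorem card_compatible_le (R : Str k ℕ) {B : Finset ℕ} {n : ℕ} (t : Fin n → Option B) :
    (Finset.univ.filter fun s : Str k (Fin n) => ∃ v, trunc B v = t ∧ R.comap v = s).card ≤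
      2 ^ freeCard k t := by
  let A := Finset.univ.filter fun a : Fin k → Fin n => ∃ i, t (a i) = none
  have hcard : (Finset.univ : Finset (A → Prop)).card = 2 ^ freeCard k t := by
    rw [Finset.card_univ, Fintype.card_fun, Fintype.card_prop, Fintype.card_coe]
    rfl
  rw [← hcard]
  refine Finset.card_le_card_of_injOn (fun s a => s a.1) (fun _ _ => Finset.mem_univ _) ?_
  intro s hs s' hs' h
  obtain ⟨-, v, hv, rfl⟩ := Finset.mem_filter.1 hs
  obtain ⟨-, v', hv', rfl⟩ := Finset.mem_filter.1 hs'
  funext a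
  by_cases ha : a ∈ A
  · exact congrFun h ⟨a, ha⟩
  · have : v ∘ a = v' ∘ a := by
      funext i
      refine eq_of_trunc_eq (hv.trans hv'.symm) fun h0 => ha ?_
      exact Finset.mem_filter.2 ⟨Finset.mem_univ _, i, hv ▸ h0⟩
    show R (v ∘ a) = R (v' ∘ a)
    rw [this]

open Classical in
/-- The weights `2 ^ -length` of a code for the structures on `n` vertices: first a truncation is
described, and then the relation on the tuples that it leaves free, with one bit for each. A
structure that arises from several truncations gets the sum of the weights. -/
noncomputable def codeWeight (R : Str k ℕ) (B : Finset ℕ) {n : ℕ} (s : Str k (Fin n)) : ℝ :=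
  ∑ t : Fin n → Option B, if ∃ v, trunc B v = t ∧ R.comap v = s then
    (((B.card : ℝ) + 1) ^ n * 2 ^ freeCard k t)⁻¹ else 0

theorem codeWeight_nonneg (R : Str k ℕ) (B : Finset ℕ) {n : ℕ} (s : Str k (Fin n)) :
    0 ≤ R.codeWeight B s :=
  Finset.sum_nonneg fun t _ => by split_ifs <;> positivity

theorem le_codeWeight_comap (R : Str k ℕ) (B : Finset ℕ) {n : ℕ} (v : Fin n → ℕ) :
    (((B.card : ℝ) + 1) ^ n * 2 ^ freeCard k (trunc B v))⁻¹ ≤ R.codeWeight B (R.comap v) := by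
  classical
  refine le_trans (le_of_eq ?_) (Finset.single_le_sum
    (fun t _ => by split_ifs <;> positivity) (Finset.mem_univ (trunc B v)))
  rw [if_pos ⟨v, rfl, rfl⟩]

theorem sum_codeWeight_le_one (R : Str k ℕ) (B : Finset ℕ) (n : ℕ) :
    ∑ s : Str k (Fin n), R.codeWeight B s ≤ 1 := by
  classical
  have hB : (0 : ℝ) < ((B.card : ℝ) + 1) ^ n := by positivity
  simp only [codeWeight]
  rw [Finset.sum_comm]
  have h : ∀ t : Fin n → Option B, (∑ s : Str k (Fin n),
      if ∃ v, trunc B v = t ∧ R.comap v = s then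
        (((B.card : ℝ) + 1) ^ n * 2 ^ freeCard k t)⁻¹ else 0) ≤ (((B.card : ℝ) + 1) ^ n)⁻¹ := by
    intro t
    rw [← Finset.sum_filter, Finset.sum_const, nsmul_eq_mul, mul_inv]
    have h1 := R.card_compatible_le t
    have h2 : ((Finset.univ.filter fun s : Str k (Fin n) =>
        ∃ v, trunc B v = t ∧ R.comap v = s).card : ℝ) ≤ 2 ^ freeCard k t := by exact_mod_cast h1
    calc _ ≤ (2 : ℝ) ^ freeCard k t * ((((B.card : ℝ) + 1) ^ n)⁻¹ * (2 ^ freeCard k t)⁻¹) :=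
          mul_le_mul_of_nonneg_right h2 (by positivity)
      _ = _ := by field_simp
  refine (Finset.sum_le_sum fun t _ => h t).trans (le_of_eq ?_)
  rw [Finset.sum_const, Finset.card_univ, Fintype.card_fun, Fintype.card_option, Fintype.card_coe,
    Fintype.card_fin, nsmul_eq_mul]
  push_cast
  exact mul_inv_cancel₀ hB.ne'

theorem integrable_freeCard_trunc (k : ℕ) (μ : Measure ℕ) [IsProbabilityMeasure μ] (B : Finset ℕ)
    (n : ℕ) : Integrable (fun v : Fin n → ℕ => (freeCard k (trunc B v) : ℝ))
      (Measure.pi fun _ : Fin n => μ) := by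
  refine Integrable.of_bound (measurable_of_countable _).aestronglyMeasurable
    (Fintype.card (Fin k → Fin n) : ℝ) (ae_of_all _ fun v => ?_)
  rw [Real.norm_of_nonneg (by positivity)]
  exact_mod_cast Finset.card_le_univ _

theorem integral_freeCard_trunc_le (k : ℕ) (μ : Measure ℕ) [IsProbabilityMeasure μ]
    (B : Finset ℕ) (n : ℕ) :
    ∫ v : Fin n → ℕ, (freeCard k (trunc B v) : ℝ) ∂(Measure.pi fun _ => μ) ≤
      k * μ.real (B : Set ℕ)ᶜ * n ^ k := by
  classical
  have hint : ∀ j : Fin n, Integrable (fun v : Fin n → ℕ => if v j ∉ B then (1 : ℝ) else 0)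
      (Measure.pi fun _ => μ) := fun j =>
    Integrable.of_bound (measurable_of_countable _).aestronglyMeasurable 1
      (ae_of_all _ fun v => by split_ifs <;> simp)
  have hval : ∀ j : Fin n, ∫ v : Fin n → ℕ, (if v j ∉ B then (1 : ℝ) else 0)
      ∂(Measure.pi fun _ => μ) = μ.real (B : Set ℕ)ᶜ := by
    intro j
    have hmp := measurePreserving_eval (fun _ : Fin n => μ) j
    have h1 := integral_map (μ := Measure.pi fun _ : Fin n => μ) hmp.measurable.aemeasurable
      (f := fun x : ℕ => if x ∉ B then (1 : ℝ) else 0)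
      (measurable_of_countable _).aestronglyMeasurable
    rw [hmp.map_eq] at h1
    rw [← h1]
    have : (fun x : ℕ => if x ∉ B then (1 : ℝ) else 0) = (B : Set ℕ)ᶜ.indicator 1 := by
      funext x; simp [Set.indicator_apply]
    rw [this, integral_indicator_one (Set.to_countable _).measurableSet]
  calc _ ≤ ∫ v : Fin n → ℕ, ∑ a : Fin k → Fin n, ∑ i : Fin k,
        (if v (a i) ∉ B then (1 : ℝ) else 0) ∂(Measure.pi fun _ => μ) := by
        refine integral_mono (integrable_freeCard_trunc k μ B n)
          (integrable_finsetSum _ fun a _ => integrable_finsetSum _ fun i _ => hint (a i))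
          fun v => ?_
        show ((Finset.univ.filter
          fun a : Fin k → Fin n => ∃ i, trunc B v (a i) = none).card : ℝ) ≤ _
        rw [Finset.card_filter, Nat.cast_sum]
        refine Finset.sum_le_sum fun a _ => ?_
        have h0 : ∀ i ∈ Finset.univ, (0 : ℝ) ≤ if v (a i) ∉ B then (1 : ℝ) else 0 :=
          fun i _ => by split_ifs <;> norm_num
        by_cases h : ∃ i, trunc B v (a i) = none
        · obtain ⟨i, hi⟩ := h
          have := Finset.single_le_sum h0 (Finset.mem_univ i)
          rw [if_pos (trunc_eq_none.1 hi)] at this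
          rw [if_pos ⟨i, hi⟩]
          exact_mod_cast this
        · rw [if_neg h]
          simpa using Finset.sum_nonneg h0
    _ = k * μ.real (B : Set ℕ)ᶜ * n ^ k := by
        rw [integral_finsetSum _ fun a _ => integrable_finsetSum _ fun i _ => hint (a i)]
        simp_rw [integral_finsetSum _ fun i _ => hint _, hval]
        simp
        ring

/-- The cost of the code: `n` entries in `Option B`, and the expected number of free tuples. -/
theorem toReal_entropy_sampleLaw_le (R : Str k ℕ) (μ : Measure ℕ) [IsProbabilityMeasure μ]
    (B : Finset ℕ) (n : ℕ) :
    (entropy (R.sampleLaw μ n)).toReal ≤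
      n * Real.logb 2 (B.card + 1) + k * μ.real (B : Set ℕ)ᶜ * n ^ k := by
  classical
  have hq : ∀ v : Fin n → ℕ, (0 : ℝ) < (((B.card : ℝ) + 1) ^ n * 2 ^ freeCard k (trunc B v))⁻¹ :=
    fun v => by positivity
  have hsum : ∑ s : Str k (Fin n), (R.sampleLaw μ n).real {s} = 1 := by
    rw [sum_measureReal_singleton]
    simp
  have hpos : ∀ s : Str k (Fin n), 0 < (R.sampleLaw μ n).real {s} → 0 < R.codeWeight B s := by
    intro s hs
    rw [Measure.real, sampleLaw, Measure.map_apply (measurable_comap R n)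
      (measurableSet_singleton s)] at hs
    obtain ⟨v, rfl⟩ := nonempty_of_measure_ne_zero
      (fun h0 => by rw [h0] at hs; simp at hs)
    exact (hq v).trans_le (R.le_codeWeight_comap B v)
  rw [toReal_entropy]
  refine (sum_neg_mul_logb_le (fun s => measureReal_nonneg) (R.codeWeight_nonneg B) hpos hsum
    (R.sum_codeWeight_le_one B n)).trans ?_
  have hint := integral_fintype (μ := R.sampleLaw μ n)
    (f := fun s => -Real.logb 2 (R.codeWeight B s)) (Integrable.of_finite)
  simp only [smul_eq_mul] at hint
  rw [← hint, sampleLaw, integral_map (measurable_comap R n).aemeasurable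
    (measurable_of_countable _).aestronglyMeasurable]
  have hi2 : Integrable (fun v : Fin n → ℕ => -Real.logb 2 (R.codeWeight B (R.comap v)))
      (Measure.pi fun _ : Fin n => μ) := by
    have : Integrable (fun s => -Real.logb 2 (R.codeWeight B s)) (R.sampleLaw μ n) :=
      Integrable.of_finite
    exact this.comp_measurable (measurable_comap R n)
  have hi3 := integrable_freeCard_trunc k μ B n
  calc ∫ v : Fin n → ℕ, -Real.logb 2 (R.codeWeight B (R.comap v)) ∂(Measure.pi fun _ => μ)
      ≤ ∫ v : Fin n → ℕ, (n * Real.logb 2 (B.card + 1) + (freeCard k (trunc B v) : ℝ))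
          ∂(Measure.pi fun _ => μ) := by
        refine integral_mono hi2 ((integrable_const _).add hi3) fun v => ?_
        have h1 := Real.logb_le_logb_of_le one_lt_two (hq v) (R.le_codeWeight_comap B v)
        rw [Real.logb_inv, Real.logb_mul (by positivity) (by positivity), Real.logb_pow,
          Real.logb_pow, Real.logb_self_eq_one one_lt_two, mul_one] at h1
        show -Real.logb 2 (R.codeWeight B (R.comap v)) ≤ _
        linarith
    _ = n * Real.logb 2 (B.card + 1) + ∫ v : Fin n → ℕ, (freeCard k (trunc B v) : ℝ)
          ∂(Measure.pi fun _ => μ) := by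
        rw [integral_add (integrable_const _) hi3]
        simp
    _ ≤ _ := by
        have := integral_freeCard_trunc_le k μ B n
        linarith

/-- The structures sampled from a countable structure have entropy `o(n ^ k)`. -/
theorem isLittleO_toReal_entropy_sampleLaw (hk : 2 ≤ k) (R : Str k ℕ) (μ : Measure ℕ)
    [IsProbabilityMeasure μ] :
    (fun n => (entropy (R.sampleLaw μ n)).toReal) =o[atTop] fun n : ℕ => (n : ℝ) ^ k := by
  rw [Asymptotics.isLittleO_iff]
  intro ε hε
  have htail : Tendsto (fun m : ℕ => μ.real ((Finset.range m : Finset ℕ) : Set ℕ)ᶜ) atTop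
      (nhds 0) := by
    have h1 : Tendsto (fun m : ℕ => μ (((Finset.range m : Finset ℕ) : Set ℕ)ᶜ)) atTop
        (nhds (μ (⋂ m : ℕ, ((Finset.range m : Finset ℕ) : Set ℕ)ᶜ))) := by
      refine tendsto_measure_iInter_atTop
        (fun m => (Set.to_countable _).measurableSet.nullMeasurableSet) ?_ ⟨0, measure_ne_top _ _⟩
      intro a b hab
      exact Set.compl_subset_compl.2 (by exact_mod_cast Finset.range_mono hab)
    have h2 : (⋂ m : ℕ, ((Finset.range m : Finset ℕ) : Set ℕ)ᶜ) = ∅ := by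
      ext v
      simp only [Finset.coe_range, Set.mem_iInter, Set.mem_compl_iff, Set.mem_Iio, not_lt,
        Set.mem_empty_iff_false, iff_false, not_forall, not_le]
      exact ⟨v + 1, Nat.lt_succ_self v⟩
    rw [h2, measure_empty] at h1
    exact (ENNReal.tendsto_toReal ENNReal.zero_ne_top).comp h1
  have hk0 : (0 : ℝ) < k := by exact_mod_cast (by omega : 0 < k)
  obtain ⟨m, hm⟩ := (htail.eventually_lt_const (show 0 < ε / (2 * k) by positivity)).exists
  set B := Finset.range m
  obtain ⟨n₀, hn₀⟩ := exists_nat_ge (2 * Real.logb 2 (B.card + 1) / ε)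
  filter_upwards [eventually_ge_atTop (max n₀ 1)] with n hn
  have hn1 : (1 : ℝ) ≤ n := by exact_mod_cast (le_max_right _ _).trans hn
  have hn2 : 2 * Real.logb 2 (B.card + 1) / ε ≤ n :=
    hn₀.trans (by exact_mod_cast (le_max_left _ _).trans hn)
  rw [Real.norm_of_nonneg ENNReal.toReal_nonneg, Real.norm_of_nonneg (by positivity)]
  refine (toReal_entropy_sampleLaw_le R μ B n).trans ?_
  have h1 : (n : ℝ) * Real.logb 2 (B.card + 1) ≤ ε / 2 * n ^ k := by
    rw [div_le_iff₀ hε] at hn2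
    calc (n : ℝ) * Real.logb 2 (B.card + 1) ≤ n * (ε / 2 * n) :=
          mul_le_mul_of_nonneg_left (by linarith) (by positivity)
      _ = ε / 2 * n ^ 2 := by ring
      _ ≤ ε / 2 * n ^ k := mul_le_mul_of_nonneg_left (pow_le_pow_right₀ hn1 hk) (by positivity)
  have h2 : k * μ.real (B : Set ℕ)ᶜ * (n : ℝ) ^ k ≤ ε / 2 * n ^ k := by
    refine mul_le_mul_of_nonneg_right ?_ (by positivity)
    calc (k : ℝ) * μ.real (B : Set ℕ)ᶜ ≤ k * (ε / (2 * k)) :=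
          mul_le_mul_of_nonneg_left hm.le hk0.le
      _ = ε / 2 := by field_simp
  linarith

end Str

/-! ### Independent samples from a distribution on `ℕ` -/

/-- A reverse Markov inequality: a function with values in `[0, M]` whose mean exceeds `x` is at
least `x` with a probability bounded below. -/
theorem integral_le_add_mul_measureReal {Ω : Type*} [MeasurableSpace Ω] [Countable Ω]
    [MeasurableSingletonClass Ω] (P : Measure Ω) [IsProbabilityMeasure P] {f : Ω → ℝ} {M x : ℝ}
    (h0 : ∀ ω, 0 ≤ f ω) (hM : ∀ ω, f ω ≤ M) (hx : 0 ≤ x) :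
    ∫ ω, f ω ∂P ≤ x + M * P.real {ω | x ≤ f ω} := by
  classical
  have hf : Integrable f P := Integrable.of_bound (measurable_of_countable f).aestronglyMeasurable
    M (ae_of_all _ fun ω => by rw [Real.norm_of_nonneg (h0 ω)]; exact hM ω)
  have hs : MeasurableSet {ω | x ≤ f ω} := (Set.to_countable _).measurableSet
  have hi : Integrable ({ω | x ≤ f ω}.indicator (1 : Ω → ℝ)) P :=
    (integrable_const (1 : ℝ)).indicator hs
  calc ∫ ω, f ω ∂P ≤ ∫ ω, (x + M * {ω | x ≤ f ω}.indicator (1 : Ω → ℝ) ω) ∂P := by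
        refine integral_mono hf ((integrable_const _).add (hi.const_mul M)) fun ω => ?_
        show f ω ≤ x + M * {ω | x ≤ f ω}.indicator (1 : Ω → ℝ) ω
        by_cases h : x ≤ f ω
        · rw [Set.indicator_of_mem (s := {ω | x ≤ f ω}) h]
          have := hM ω
          simp only [Pi.one_apply, mul_one]
          linarith
        · rw [Set.indicator_of_notMem (s := {ω | x ≤ f ω}) h]
          simp only [mul_zero, add_zero]
          exact (not_le.1 h).le
    _ = x + M * P.real {ω | x ≤ f ω} := by
        rw [integral_add (integrable_const _) (hi.const_mul M), integral_const_mul,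
          integral_indicator_one hs]
        simp

section Sampling

variable {ι : Type*} [Fintype ι] (μ : Measure ℕ) [IsProbabilityMeasure μ]

open Classical in
/-- If, within `C`, the conditions `ok i` have density at most `δ`, then at most a proportion
`δ ^ m` of the samples meet `C` at least `m` times, and each time in accordance with `ok`. -/
theorem measureReal_pi_le_pow {C : Set ℕ} {ok : ι → Set ℕ} {δ : ℝ} (hδ0 : 0 < δ) (hδ1 : δ ≤ 1)
    (hok : ∀ i, μ.real (C ∩ ok i) ≤ δ * μ.real C) (m : ℕ) :
    (Measure.pi fun _ : ι => μ).real {w | m ≤ (Finset.univ.filter fun i => w i ∈ C).card ∧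
      ∀ i, w i ∈ C → w i ∈ ok i} ≤ δ ^ m := by
  have hms : ∀ D : Set ℕ, MeasurableSet D := fun D => (Set.to_countable D).measurableSet
  -- The indicator function of the event is at most `δ ^ m * ∏ i, φ i (w i)`, and `φ i` has mean
  -- at most `1`.
  let φ : ι → ℕ → ℝ := fun i => Cᶜ.indicator (1 : ℕ → ℝ) + δ⁻¹ • (C ∩ ok i).indicator (1 : ℕ → ℝ)
  have hφ0 : ∀ i c, 0 ≤ φ i c := by
    intro i c
    simp only [φ, Pi.add_apply, Pi.smul_apply, smul_eq_mul, Set.indicator_apply, Pi.one_apply]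
    split_ifs <;> positivity
  have hφm : ∀ i c, c ∉ C → φ i c = 1 := fun i c h => by simp [φ, h]
  have hφC : ∀ i c, c ∈ C → c ∈ ok i → φ i c = δ⁻¹ := fun i c h h' => by simp [φ, h, h']
  have hφb : ∀ i c, φ i c ≤ δ⁻¹ := by
    intro i c
    have h1 := (one_le_inv₀ hδ0).2 hδ1
    by_cases hc : c ∈ C
    · by_cases hc' : c ∈ ok i
      · exact (hφC i c hc hc').le
      · simpa [φ, hc, hc'] using hδ0.le
    · rw [hφm i c hc]; exact h1
  have hi1 : ∀ D : Set ℕ, Integrable (D.indicator (1 : ℕ → ℝ)) μ := fun D =>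
    (integrable_const (1 : ℝ)).indicator (hms D)
  have hint : ∀ i, ∫ c, φ i c ∂μ ≤ 1 := by
    intro i
    have : ∫ c, φ i c ∂μ = μ.real Cᶜ + δ⁻¹ * μ.real (C ∩ ok i) := by
      simp only [φ, Pi.add_apply, Pi.smul_apply, smul_eq_mul]
      rw [integral_add (hi1 _) ((hi1 _).const_mul _), integral_const_mul,
        integral_indicator_one (hms _), integral_indicator_one (hms _)]
    rw [this, probReal_compl_eq_one_sub (hms C)]
    have h2 : δ⁻¹ * μ.real (C ∩ ok i) ≤ δ⁻¹ * (δ * μ.real C) :=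
      mul_le_mul_of_nonneg_left (hok i) (by positivity)
    rw [inv_mul_cancel_left₀ hδ0.ne'] at h2
    linarith
  set E : Set (ι → ℕ) := {w | m ≤ (Finset.univ.filter fun i => w i ∈ C).card ∧
      ∀ i, w i ∈ C → w i ∈ ok i} with hE
  have hEm : MeasurableSet E := (Set.to_countable E).measurableSet
  have hprod0 : ∀ w : ι → ℕ, 0 ≤ ∏ i, φ i (w i) := fun w =>
    Finset.prod_nonneg fun i _ => hφ0 i _
  calc (Measure.pi fun _ : ι => μ).real E
      = ∫ w, E.indicator (1 : (ι → ℕ) → ℝ) w ∂(Measure.pi fun _ : ι => μ) :=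
        (integral_indicator_one hEm).symm
    _ ≤ ∫ w, δ ^ m * ∏ i, φ i (w i) ∂(Measure.pi fun _ : ι => μ) := by
        refine integral_mono ((integrable_const (1 : ℝ)).indicator hEm) ?_ fun w => ?_
        · refine Integrable.of_bound (measurable_of_countable _).aestronglyMeasurable
            (δ ^ m * δ⁻¹ ^ Fintype.card ι) (ae_of_all _ fun w => ?_)
          rw [Real.norm_of_nonneg (mul_nonneg (by positivity) (hprod0 w))]
          refine mul_le_mul_of_nonneg_left ?_ (by positivity)
          have := Finset.prod_le_prod (fun i (_ : i ∈ Finset.univ) => hφ0 i (w i))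
            fun i _ => hφb i (w i)
          simpa using this
        · show E.indicator (1 : (ι → ℕ) → ℝ) w ≤ δ ^ m * ∏ i, φ i (w i)
          by_cases hw : w ∈ E
          · rw [Set.indicator_of_mem hw]
            have h1 : ∏ i, φ i (w i) = δ⁻¹ ^ (Finset.univ.filter fun i => w i ∈ C).card := by
              rw [← Finset.prod_const, Finset.prod_filter]
              refine Finset.prod_congr rfl fun i _ => ?_
              by_cases hi : w i ∈ C
              · rw [if_pos hi, hφC i _ hi (hw.2 i hi)]
              · rw [if_neg hi, hφm i _ hi]
            have h2 : δ⁻¹ ^ m ≤ ∏ i, φ i (w i) :=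
              h1 ▸ pow_le_pow_right₀ ((one_le_inv₀ hδ0).2 hδ1) hw.1
            calc (1 : ℝ) = δ ^ m * δ⁻¹ ^ m := by
                  rw [← mul_pow, mul_inv_cancel₀ hδ0.ne', one_pow]
              _ ≤ _ := mul_le_mul_of_nonneg_left h2 (by positivity)
          · rw [Set.indicator_of_notMem hw]
            exact mul_nonneg (by positivity) (hprod0 w)
    _ = δ ^ m * ∏ i, ∫ c, φ i c ∂μ := by
        rw [integral_const_mul, integral_fintype_prod_eq_prod (μ := fun _ : ι => μ)]
    _ ≤ δ ^ m * 1 := by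
        refine mul_le_mul_of_nonneg_left (Finset.prod_le_one ?_ fun i _ => hint i) (by positivity)
        exact fun i _ => integral_nonneg (hφ0 i)
    _ = δ ^ m := mul_one _

theorem integral_eval_pi (i : ι) (D : Set ℕ) :
    ∫ w : ι → ℕ, D.indicator (1 : ℕ → ℝ) (w i) ∂(Measure.pi fun _ => μ) = μ.real D := by
  have hmp := measurePreserving_eval (fun _ : ι => μ) i
  have h1 := integral_map (μ := Measure.pi fun _ : ι => μ) hmp.measurable.aemeasurable
    (f := D.indicator (1 : ℕ → ℝ)) (measurable_of_countable _).aestronglyMeasurable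
  rw [hmp.map_eq] at h1
  rw [← integral_indicator_one (Set.to_countable D).measurableSet, h1]

open Classical in
/-- At least half of the expected number of hits of `C` occurs with probability at least
`μ C / 2`. -/
theorem le_measureReal_card_hits (C : Set ℕ) [Nonempty ι] :
    μ.real C / 2 ≤ (Measure.pi fun _ : ι => μ).real {w : ι → ℕ |
      Fintype.card ι * μ.real C / 2 ≤ ((Finset.univ.filter fun i => w i ∈ C).card : ℝ)} := by
  have hcard : (0 : ℝ) < Fintype.card ι := by exact_mod_cast Fintype.card_pos
  have h := integral_le_add_mul_measureReal (Measure.pi fun _ : ι => μ)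
    (f := fun w => ((Finset.univ.filter fun i => w i ∈ C).card : ℝ)) (M := Fintype.card ι)
    (x := Fintype.card ι * μ.real C / 2) (fun w => by positivity)
    (fun w => by exact_mod_cast Finset.card_le_univ _) (by positivity)
  have hE : ∫ w : ι → ℕ, ((Finset.univ.filter fun i => w i ∈ C).card : ℝ)
      ∂(Measure.pi fun _ => μ) = Fintype.card ι * μ.real C := by
    have : ∀ w : ι → ℕ, ((Finset.univ.filter fun i => w i ∈ C).card : ℝ) =
        ∑ i, C.indicator (1 : ℕ → ℝ) (w i) := by
      intro w
      simp [Set.indicator_apply]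
    simp_rw [this]
    rw [integral_finsetSum]
    · simp [integral_eval_pi]
    · exact fun i _ => Integrable.of_bound (measurable_of_countable _).aestronglyMeasurable 1
        (ae_of_all _ fun w => by
          rw [Set.indicator_apply]; split_ifs <;> simp)
  rw [hE] at h
  have h2 : (Fintype.card ι : ℝ) * (μ.real C / 2) ≤ Fintype.card ι *
    (Measure.pi fun _ : ι => μ).real {w : ι → ℕ |
      Fintype.card ι * μ.real C / 2 ≤ ((Finset.univ.filter fun i => w i ∈ C).card : ℝ)} := by
    linarith
  exact le_of_mul_le_mul_left h2 hcard

theorem one_sub_pow_le {x : ℝ} (hx0 : 0 ≤ x) (hx1 : x ≤ 1) {h : ℕ} (hh : h * x ≤ 1) :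
    (1 - x) ^ h ≤ 1 - h * x / 2 := by
  have h1 : 1 + h * x ≤ (1 + x) ^ h := one_add_mul_le_pow (by linarith) h
  have h2 : (1 - x) ^ h * (1 + x) ^ h ≤ 1 := by
    rw [← mul_pow]
    exact pow_le_one₀ (by nlinarith) (by nlinarith)
  have h3 : (1 - x) ^ h * (1 + h * x) ≤ 1 :=
    (mul_le_mul_of_nonneg_left h1 (pow_nonneg (by linarith) h)).trans h2
  have h0 : (0 : ℝ) ≤ h * x := by positivity
  have h4 : (1 : ℝ) ≤ (1 - h * x / 2) * (1 + h * x) := by nlinarith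
  exact le_of_mul_le_mul_right (h3.trans h4) (by linarith)

open Classical in
/-- If `A` consists of atoms of equal and small enough weight, then, with a probability bounded
below in terms of `μ A`, a sample has many different values in `A`. -/
theorem le_measureReal_card_range [Nonempty ι] {A : Finset ℕ} {α : ℝ}
    (hα : ∀ a ∈ A, μ.real {a} = α) (hα0 : 0 ≤ α) (hα1 : Fintype.card ι * α ≤ 1) :
    A.card * α / 4 ≤ (Measure.pi fun _ : ι => μ).real {u : ι → ℕ |
      Fintype.card ι * (A.card * α) / 4 ≤ ((A.filter fun a => ∃ i, u i = a).card : ℝ)} := by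
  have hms : ∀ D : Set (ι → ℕ), MeasurableSet D := fun D => (Set.to_countable D).measurableSet
  have hcard : (1 : ℝ) ≤ Fintype.card ι := by exact_mod_cast Fintype.card_pos
  have hbound : ∀ u : ι → ℕ, (A.filter fun a => ∃ i, u i = a).card ≤ Fintype.card ι := by
    intro u
    calc (A.filter fun a => ∃ i, u i = a).card ≤ (Finset.univ.image u).card := by
          refine Finset.card_le_card fun a ha => ?_
          obtain ⟨i, rfl⟩ := (Finset.mem_filter.1 ha).2
          exact Finset.mem_image_of_mem _ (Finset.mem_univ i)
      _ ≤ Fintype.card ι := Finset.card_image_le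
  have h := integral_le_add_mul_measureReal (Measure.pi fun _ : ι => μ)
    (f := fun u => ((A.filter fun a => ∃ i, u i = a).card : ℝ)) (M := Fintype.card ι)
    (x := Fintype.card ι * (A.card * α) / 4) (fun w => by positivity)
    (fun w => by exact_mod_cast hbound w) (by positivity)
  have hhit : ∀ a ∈ A, Fintype.card ι * α / 2 ≤
      (Measure.pi fun _ : ι => μ).real {u : ι → ℕ | ∃ i, u i = a} := by
    intro a ha
    have h1 : {u : ι → ℕ | ∃ i, u i = a} = (Set.univ.pi fun _ : ι => ({a}ᶜ : Set ℕ))ᶜ := by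
      ext u; simp [Set.mem_pi]
    have h2 : (Measure.pi fun _ : ι => μ).real (Set.univ.pi fun _ : ι => ({a}ᶜ : Set ℕ)) =
        (1 - α) ^ Fintype.card ι := by
      rw [Measure.real, Measure.pi_pi, ENNReal.toReal_prod]
      have : (μ {a}ᶜ).toReal = 1 - α := by
        rw [← hα a ha]
        exact probReal_compl_eq_one_sub (measurableSet_singleton a)
      simp [this]
    rw [h1, probReal_compl_eq_one_sub (hms _), h2]
    have hα1' : α ≤ 1 := by nlinarith
    have := one_sub_pow_le hα0 hα1' hα1
    linarith
  have hE : A.card * (Fintype.card ι * α / 2) ≤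
      ∫ u : ι → ℕ, ((A.filter fun a => ∃ i, u i = a).card : ℝ) ∂(Measure.pi fun _ => μ) := by
    have : ∀ u : ι → ℕ, ((A.filter fun a => ∃ i, u i = a).card : ℝ) =
        ∑ a ∈ A, {u : ι → ℕ | ∃ i, u i = a}.indicator (1 : (ι → ℕ) → ℝ) u := by
      intro u
      simp [Set.indicator_apply]
    simp_rw [this]
    rw [integral_finsetSum]
    · simp_rw [integral_indicator_one (hms _)]
      have := Finset.card_nsmul_le_sum A _ _ hhit
      simpa using this
    · exact fun a _ => (integrable_const (1 : ℝ)).indicator (hms _)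
  have h2 : (Fintype.card ι : ℝ) * (A.card * α / 4) ≤ Fintype.card ι *
    (Measure.pi fun _ : ι => μ).real {u : ι → ℕ |
      Fintype.card ι * (A.card * α) / 4 ≤ ((A.filter fun a => ∃ i, u i = a).card : ℝ)} := by
    have e : (A.card : ℝ) * (Fintype.card ι * α / 2) =
      Fintype.card ι * (A.card * α) / 4 + Fintype.card ι * (A.card * α / 4) := by ring
    linarith
  exact le_of_mul_le_mul_left h2 (by linarith)

end Sampling

/-! ### Entropy of samples from a block system -/

namespace BlockSystem

variable (S : BlockSystem) {k : ℕ}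

open Classical in
/-- For fixed vertices `u`, many of them in block `j`, a sample `w` that hits block `j + 1` many
times rarely induces, together with `u`, a given structure `s`: each hit has to connect in a
prescribed way to all the `k`-element sets of vertices of block `j` that occur in `u`. -/
theorem measureReal_comap_eq_le_of_fixed {ι : Type*} [Fintype ι] (p : ι → Prop) (j : ℕ)
    (s : Str (k + 1) ι) (u : {i // p i} → ℕ) (mA mC : ℕ)
    (hmA : mA ≤ ((S.block j).filter fun a => ∃ i, u i = a).card) :
    (Measure.pi fun _ : {i // ¬p i} => S.measure).real {w |
      (S.graph (k + 1)).comap (fun i => if h : p i then u ⟨i, h⟩ else w ⟨i, h⟩) = s ∧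
      mC ≤ (Finset.univ.filter fun i => w i ∈ S.block (j + 1)).card} ≤
    (2⁻¹ ^ mA.choose k) ^ mC := by
  set A := (S.block j).filter fun a => ∃ i, u i = a with hA
  let Q := A.powersetCard k
  have hQ : ∀ F ∈ Q, ∀ a ∈ F, S.blk a = j := fun F hF a ha =>
    S.mem_block.1 (Finset.mem_filter.1 ((Finset.mem_powersetCard.1 hF).1 ha)).1
  -- `g i F` says whether `s` requires that `F` belong to the link of the vertex at `i`.
  let g : {i // ¬p i} → Finset ℕ → Prop := fun i F => ∃ t : Fin k → {i // p i},
    Function.Injective (u ∘ t) ∧ Finset.univ.image (u ∘ t) = F ∧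
      s (Fin.cons i.1 fun l => (t l).1)
  choose T hT hTc using fun i => S.equidistributed (j + 1) Q
    (fun F hF a ha => by rw [hQ F hF a ha]; exact Nat.lt_succ_self j) (g i)
  have hδ : (0 : ℝ) < 2⁻¹ ^ Q.card := by positivity
  have hδ1 : (2⁻¹ : ℝ) ^ Q.card ≤ 1 := pow_le_one₀ (by norm_num) (by norm_num)
  have hok : ∀ i, S.measure.real ((S.block (j + 1) : Set ℕ) ∩ (T i : Set ℕ)) ≤
      2⁻¹ ^ Q.card * S.measure.real (S.block (j + 1)) := by
    intro i
    have hsub : T i ⊆ S.block (j + 1) := fun v hv => ((hT i v).1 hv).1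
    rw [Set.inter_eq_self_of_subset_right (by exact_mod_cast hsub), S.measureReal_of_subset hsub,
      S.measureReal_block, ← hTc i]
    have hTpos : (0 : ℝ) < (T i).card := by
      have := Finset.card_pos.2 (S.block_nonempty (j + 1))
      rw [← hTc i] at this
      exact_mod_cast Nat.pos_of_mul_pos_right this
    push_cast
    rw [div_mul_cancel_left₀ hTpos.ne', inv_pow (2 : ℝ) Q.card, mul_comm]
  refine le_trans (measureReal_mono ?_ (measure_ne_top _ _))
    ((measureReal_pi_le_pow S.measure hδ hδ1 hok mC).trans ?_)
  · rintro w ⟨hs, hw⟩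
    refine ⟨by simpa using hw, fun i hi => ?_⟩
    rw [Finset.mem_coe] at hi ⊢
    refine (hT i _).2 ⟨hi, fun F hF => ?_⟩
    -- For a listing `t` of `F`, the tuple `(i, t)` is an edge exactly if `F` is in the link.
    have key : ∀ t : Fin k → {i // p i}, Function.Injective (u ∘ t) →
        Finset.univ.image (u ∘ t) = F →
        (s (Fin.cons i.1 fun l => (t l).1) ↔ S.link (w i) F) := by
      intro t ht htF
      set v : ι → ℕ := fun i => if h : p i then u ⟨i, h⟩ else w ⟨i, h⟩ with hv
      have hv0 : v i.1 = w i := dif_neg i.2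
      have hvt : ∀ l, v (t l).1 = u (t l) := fun l => dif_pos (t l).2
      have hcomp : v ∘ (Fin.cons i.1 fun l => (t l).1 : Fin (k + 1) → ι) =
          Fin.cons (w i) (u ∘ t) := by
        funext l
        refine Fin.cases ?_ (fun l => ?_) l
        · simpa using hv0
        · simpa using hvt l
      have hblk : ∀ l, S.blk (u (t l)) = j := fun l =>
        hQ F hF _ (htF ▸ Finset.mem_image_of_mem (u ∘ t) (Finset.mem_univ l))
      have hblk0 : S.blk (w i) = j + 1 := S.mem_block.1 hi
      rw [← hs]
      show S.graph (k + 1) (v ∘ _) ↔ _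
      rw [hcomp, S.graph_iff_link (i := 0)]
      · rw [Fin.cons_zero, ← htF]
        have : (Finset.univ.erase (0 : Fin (k + 1))).image (Fin.cons (w i) (u ∘ t)) =
            Finset.univ.image (u ∘ t) := by
          ext x
          simp only [Finset.mem_image, Finset.mem_erase, Finset.mem_univ, and_true, true_and]
          constructor
          · rintro ⟨l, hl, rfl⟩
            obtain ⟨l', rfl⟩ := Fin.exists_succ_eq.2 hl
            exact ⟨l', by simp⟩
          · rintro ⟨l, rfl⟩
            exact ⟨l.succ, Fin.succ_ne_zero l, by simp⟩
        rw [this]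
      · rw [Fin.cons_injective_iff]
        refine ⟨?_, ht⟩
        rintro ⟨l, hl⟩
        have := hblk l
        rw [show u (t l) = w i from hl, hblk0] at this
        omega
      · intro l hl
        obtain ⟨l', rfl⟩ := Fin.exists_succ_eq.2 hl
        simp [hblk, hblk0]
    constructor
    · intro hl
      have hFA := (Finset.mem_powersetCard.1 hF)
      have hex : ∀ l, ∃ i, u i = F.orderEmbOfFin hFA.2 l := fun l =>
        (Finset.mem_filter.1 (hFA.1 (F.orderEmbOfFin_mem hFA.2 l))).2
      choose t ht using hex
      have hut : u ∘ t = F.orderEmbOfFin hFA.2 := funext ht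
      have h1 : Function.Injective (u ∘ t) := hut ▸ (F.orderEmbOfFin hFA.2).injective
      have h2 : Finset.univ.image (u ∘ t) = F := by
        rw [hut]; exact Finset.image_orderEmbOfFin_univ F hFA.2
      exact ⟨t, h1, h2, (key t h1 h2).2 hl⟩
    · rintro ⟨t, h1, h2, h3⟩
      exact (key t h1 h2).1 h3
  · refine pow_le_pow_left₀ hδ.le ?_ mC
    refine pow_le_pow_of_le_one (by norm_num) (by norm_num) ?_
    rw [Finset.card_powersetCard]
    exact Nat.choose_le_choose k hmA

open Classical in
/-- The event that at least `mA` different vertices of block `j` occur at the indices in `p`, and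
that at least `mC` of the other indices hit block `j + 1`. -/
def richSamples {ι : Type*} [Fintype ι] (p : ι → Prop) (j mA mC : ℕ) : Set (ι → ℕ) :=
  {v | mA ≤ ((S.block j).filter fun a => ∃ i : {i // p i}, v i = a).card ∧
    mC ≤ (Finset.univ.filter fun i : {i // ¬p i} => v i ∈ S.block (j + 1)).card}

open Classical in
/-- The two halves of a sample are independent. -/
theorem measureReal_eq_prod {ι : Type*} [Fintype ι] (p : ι → Prop) (E : Set (ι → ℕ)) :
    (Measure.pi fun _ : ι => S.measure).real E =
      ((Measure.pi fun _ : {i // p i} => S.measure).prod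
        (Measure.pi fun _ : {i // ¬p i} => S.measure)).real
        {y | (fun i => if h : p i then y.1 ⟨i, h⟩ else y.2 ⟨i, h⟩) ∈ E} := by
  have hmp := measurePreserving_piEquivPiSubtypeProd (fun _ : ι => S.measure) p
  have h := hmp.symm.measure_preimage (Set.to_countable E).measurableSet.nullMeasurableSet
  rw [Measure.real, Measure.real, ← h]
  rfl

/-- A structure has probability at most `2 ^ -(mC * mA.choose k)` to arise from a sample that is
rich in vertices of blocks `j` and `j + 1`. -/
theorem measureReal_comap_eq_inter_le {ι : Type*} [Fintype ι] (p : ι → Prop) (j mA mC : ℕ)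
    (s : Str (k + 1) ι) :
    (Measure.pi fun _ : ι => S.measure).real
      ({v | (S.graph (k + 1)).comap v = s} ∩ S.richSamples p j mA mC) ≤
    (2⁻¹ ^ mA.choose k) ^ mC := by
  classical
  rw [S.measureReal_eq_prod p, Measure.real, Measure.prod_apply (Set.to_countable _).measurableSet]
  refine ENNReal.toReal_le_of_le_ofReal (by positivity) ?_
  have h : ∀ u : {i // p i} → ℕ, (Measure.pi fun _ : {i // ¬p i} => S.measure)
      (Prod.mk u ⁻¹' {y : ({i // p i} → ℕ) × ({i // ¬p i} → ℕ) |
        (fun i => if h : p i then y.1 ⟨i, h⟩ else y.2 ⟨i, h⟩) ∈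
        ({v | (S.graph (k + 1)).comap v = s} ∩ S.richSamples p j mA mC)}) ≤
      ENNReal.ofReal ((2⁻¹ ^ mA.choose k) ^ mC) := by
    intro u
    by_cases hmA : mA ≤ ((S.block j).filter fun a => ∃ i, u i = a).card
    · rw [← ofReal_measureReal (measure_ne_top _ _)]
      refine ENNReal.ofReal_le_ofReal (le_trans (measureReal_mono ?_ (measure_ne_top _ _))
        (S.measureReal_comap_eq_le_of_fixed p j s u mA mC hmA))
      rintro w ⟨hs, -, hw⟩
      refine ⟨hs, hw.trans (le_of_eq ?_)⟩
      congr 1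
      ext i
      simp [i.2]
    · refine le_of_eq_of_le (measure_mono_null ?_ (measure_empty (μ :=
        Measure.pi fun _ : {i // ¬p i} => S.measure))) (zero_le)
      rintro w ⟨-, h, -⟩
      refine absurd (h.trans (le_of_eq ?_)) hmA
      congr 1
      ext a
      refine Finset.mem_filter.trans (Iff.trans (and_congr_right fun _ => ?_)
        Finset.mem_filter.symm)
      refine exists_congr fun i => ?_
      simp [i.2]
  refine (lintegral_mono h).trans ?_
  simp

/-- Rich samples have a probability bounded below in terms of `j` alone. The bounds on `mA` and `mC`
say that these may be the least integers above a constant proportion of the numbers of indices. -/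
theorem le_measureReal_richSamples {ι : Type*} [Fintype ι] (p : ι → Prop) (j mA mC : ℕ)
    [Nonempty {i // p i}] [Nonempty {i // ¬p i}]
    (hι : Nat.card {i // p i} ≤ (S.block j).card)
    (hmA : (mA : ℝ) < Nat.card {i // p i} * 2⁻¹ ^ (j + 1) / 4 + 1)
    (hmC : (mC : ℝ) < Nat.card {i // ¬p i} * 2⁻¹ ^ (j + 2) / 2 + 1) :
    2⁻¹ ^ (j + 1) / 4 * (2⁻¹ ^ (j + 2) / 2) ≤
      (Measure.pi fun _ : ι => S.measure).real (S.richSamples p j mA mC) := by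
  classical
  rw [Nat.card_eq_fintype_card] at hι hmA hmC
  have hc : (0 : ℝ) < (S.block j).card := by exact_mod_cast Finset.card_pos.2 (S.block_nonempty j)
  have hα : ∀ a ∈ S.block j, S.measure.real {a} = 2⁻¹ ^ (j + 1) * (1 / (S.block j).card) := by
    intro a ha
    have := S.measureReal_of_subset (j := j) (T := {a}) (by simpa using ha)
    simpa using this
  have hβ : (2⁻¹ : ℝ) ^ (j + 1) ≤ 1 := pow_le_one₀ (by norm_num) (by norm_num)
  have hα1 : Fintype.card {i // p i} * ((2⁻¹ : ℝ) ^ (j + 1) * (1 / (S.block j).card)) ≤ 1 := by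
    have h1 : (Fintype.card {i // p i} : ℝ) ≤ (S.block j).card := by exact_mod_cast hι
    calc _ = (Fintype.card {i // p i} / (S.block j).card : ℝ) * 2⁻¹ ^ (j + 1) := by ring
      _ ≤ 1 * 1 := mul_le_mul ((div_le_one hc).2 h1) hβ (by positivity) zero_le_one
      _ = 1 := one_mul 1
  have hA := le_measureReal_card_range (ι := {i // p i}) S.measure hα (by positivity) hα1
  have hC := le_measureReal_card_hits (ι := {i // ¬p i}) S.measure (S.block (j + 1))
  rw [S.measureReal_block] at hC
  rw [show ((S.block j).card : ℝ) * (2⁻¹ ^ (j + 1) * (1 / (S.block j).card)) = 2⁻¹ ^ (j + 1) by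
    field_simp] at hA
  rw [S.measureReal_eq_prod p]
  refine (mul_le_mul hA hC (by positivity) measureReal_nonneg).trans ?_
  rw [← measureReal_prod_prod]
  refine measureReal_mono ?_ (measure_ne_top _ _)
  rintro ⟨u, w⟩ ⟨hu, hw⟩
  constructor
  · simp only [Set.mem_ofPred_eq] at hu
    have h1 := hmA.trans_le (add_le_add hu le_rfl)
    have h2 := Nat.lt_succ_iff.1 (Nat.cast_lt.1 (h1.trans_eq (Nat.cast_succ _).symm))
    refine h2.trans (le_of_eq ?_)
    congr 1
    ext a
    refine Finset.mem_filter.trans (Iff.trans (and_congr_right fun _ => ?_)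
        Finset.mem_filter.symm)
    refine exists_congr fun i => ?_
    simp [i.2]
  · simp only [Set.mem_ofPred_eq] at hw
    have h1 := hmC.trans_le (add_le_add hw le_rfl)
    have h2 := Nat.lt_succ_iff.1 (Nat.cast_lt.1 (h1.trans_eq (Nat.cast_succ _).symm))
    refine h2.trans (le_of_eq ?_)
    congr 1
    ext i
    simp [i.2]

/-- The number of random bits in a sample of size `n` that is rich in vertices of blocks `j` and
`j + 1`: one for each pair of a hit of block `j + 1` in the second half and a `k`-element set of
vertices of block `j` in the first half. -/
noncomputable def bits (k j n : ℕ) : ℕ :=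
  ⌈((n - n / 2 : ℕ) : ℝ) * 2⁻¹ ^ (j + 2) / 2⌉₊ *
    (⌈((n / 2 : ℕ) : ℝ) * 2⁻¹ ^ (j + 1) / 4⌉₊).choose k

theorem le_toReal_entropy_sampleLaw (j n : ℕ) (hn2 : 2 ≤ n) (hn : n ≤ (S.block j).card) :
    (2⁻¹ ^ (j + 1) / 4 * (2⁻¹ ^ (j + 2) / 2)) / 2 * (bits k j n -
      Real.logb 2 (2 / (2⁻¹ ^ (j + 1) / 4 * (2⁻¹ ^ (j + 2) / 2)))) ≤
    (entropy ((S.graph (k + 1)).sampleLaw S.measure n)).toReal := by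
  classical
  let p : Fin n → Prop := fun i => (i : ℕ) < n / 2
  have hp : Nat.card {i // p i} = n / 2 := by
    rw [Nat.card_eq_fintype_card, Fintype.card_subtype]
    rw [Fin.card_filter_val_lt]; omega
  have hp' : Nat.card {i // ¬p i} = n - n / 2 := by
    rw [Nat.card_eq_fintype_card, Fintype.card_subtype_compl,
      ← Nat.card_eq_fintype_card (α := {i // p i}), hp, Fintype.card_fin]
  have : Nonempty {i // p i} := (Nat.card_pos_iff.1 (by omega)).1
  have : Nonempty {i // ¬p i} := (Nat.card_pos_iff.1 (by omega)).1
  let mA := ⌈((n / 2 : ℕ) : ℝ) * 2⁻¹ ^ (j + 1) / 4⌉₊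
  let mC := ⌈((n - n / 2 : ℕ) : ℝ) * 2⁻¹ ^ (j + 2) / 2⌉₊
  have hgood := S.le_measureReal_richSamples p j mA mC (by omega)
    (by rw [hp]; exact Nat.ceil_lt_add_one (by positivity))
    (by rw [hp']; exact Nat.ceil_lt_add_one (by positivity))
  set P := Measure.pi fun _ : Fin n => S.measure with hP
  set E := S.richSamples p j mA mC with hE
  have hms : ∀ D : Set (Fin n → ℕ), MeasurableSet D := fun D => (Set.to_countable D).measurableSet
  have hmeas := Str.measurable_comap (S.graph (k + 1)) n
  rw [toReal_entropy]
  refine le_sum_neg_mul_logb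
    (r := fun s => P.real ({v | (S.graph (k + 1)).comap v = s} ∩ E)) (by positivity)
    (fun s => measureReal_nonneg) (fun s => ?_) (fun s => ?_) ?_ (hgood.trans (le_of_eq ?_))
  · rw [Str.sampleLaw, map_measureReal_apply hmeas (measurableSet_singleton s)]
    exact measureReal_mono Set.inter_subset_left (measure_ne_top _ _)
  · refine (S.measureReal_comap_eq_inter_le p j mA mC s).trans (le_of_eq ?_)
    rw [Real.rpow_neg zero_le_two, Real.rpow_natCast, ← pow_mul, inv_pow, bits, mul_comm]
  · rw [sum_measureReal_singleton]
    simp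
  · have h1 : ∀ s, P.real ({v | (S.graph (k + 1)).comap v = s} ∩ E) =
        ((P.restrict E).map (S.graph (k + 1)).comap).real {s} := by
      intro s
      rw [map_measureReal_apply hmeas (measurableSet_singleton s), measureReal_restrict_apply
        (hms _)]
      rfl
    simp_rw [h1]
    rw [sum_measureReal_singleton, Finset.coe_univ, map_measureReal_apply hmeas MeasurableSet.univ]
    simp

end BlockSystem

/-! ### The choice of the block sizes -/

namespace BlockSystem

theorem exists_forall_le_bits (k j : ℕ) :
    ∃ κ : ℝ, 0 < κ ∧ ∃ t : ℕ, ∀ n : ℕ, t ≤ n → κ * (n : ℝ) ^ (k + 1) ≤ bits k j n := by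
  have hβ : (0 : ℝ) < 2⁻¹ ^ (j + 1) := by positivity
  have hγ : (0 : ℝ) < 2⁻¹ ^ (j + 2) := by positivity
  set β : ℝ := 2⁻¹ ^ (j + 1) with hβd
  set γ : ℝ := 2⁻¹ ^ (j + 2) with hγd
  obtain ⟨t, ht⟩ := exists_nat_ge (32 * k / β)
  refine ⟨γ / 4 * ((β / 32) ^ k / k.factorial), by positivity, max t 2, fun n hn => ?_⟩
  have hn2 : 2 ≤ n := (le_max_right _ _).trans hn
  have hn2' : (2 : ℝ) ≤ n := by exact_mod_cast hn2
  have hnt : 32 * k / β ≤ n := ht.trans (by exact_mod_cast (le_max_left _ _).trans hn)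
  have h1 : (n : ℝ) / 4 ≤ (n / 2 : ℕ) := by
    have : n ≤ 4 * (n / 2) := by omega
    have : (n : ℝ) ≤ 4 * (n / 2 : ℕ) := by exact_mod_cast this
    linarith
  have h2 : (n : ℝ) / 2 ≤ (n - n / 2 : ℕ) := by
    have : n ≤ 2 * (n - n / 2) := by omega
    have : (n : ℝ) ≤ 2 * (n - n / 2 : ℕ) := by exact_mod_cast this
    linarith
  set mA := ⌈((n / 2 : ℕ) : ℝ) * β / 4⌉₊ with hmA
  set mC := ⌈((n - n / 2 : ℕ) : ℝ) * γ / 2⌉₊ with hmC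
  have h3 : n * β / 16 ≤ mA := by
    refine le_trans ?_ (Nat.le_ceil _)
    have := mul_le_mul_of_nonneg_right h1 hβ.le
    linarith
  have h4 : γ / 4 * n ≤ mC := by
    refine le_trans ?_ (Nat.le_ceil _)
    have := mul_le_mul_of_nonneg_right h2 hγ.le
    linarith
  have h5 : β / 32 * n ≤ (mA + 1 - k : ℕ) := by
    have h6 : (mA : ℝ) + 1 - k ≤ (mA + 1 - k : ℕ) := by
      have h : mA + 1 ≤ (mA + 1 - k) + k := by omega
      have : ((mA : ℝ) + 1) ≤ ((mA + 1 - k : ℕ) : ℝ) + k := by exact_mod_cast h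
      linarith
    rw [div_le_iff₀ hβ] at hnt
    linarith
  have h7 : (β / 32) ^ k / k.factorial * n ^ k ≤ (mA.choose k : ℝ) := by
    refine le_trans ?_ (Nat.pow_le_choose (α := ℝ) k mA)
    rw [div_mul_eq_mul_div, ← mul_pow]
    exact div_le_div_of_nonneg_right (pow_le_pow_left₀ (by positivity) h5 k) (by positivity)
  calc γ / 4 * ((β / 32) ^ k / k.factorial) * (n : ℝ) ^ (k + 1)
      = (γ / 4 * n) * ((β / 32) ^ k / k.factorial * n ^ k) := by ring
    _ ≤ mC * mA.choose k := mul_le_mul h4 h7 (by positivity) (by positivity)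
    _ = bits k j n := by simp only [bits]; push_cast; rfl

/-- The entropy provided by the blocks `j` and `j + 1` has the order `n ^ (k + 1)`, with constants
that do not depend on the sizes of the blocks, as long as there are enough vertices. -/
theorem exists_forall_le_toReal_entropy (k j : ℕ) :
    ∃ κ : ℝ, 0 < κ ∧ ∃ t : ℕ, ∀ (S : BlockSystem) (n : ℕ), t ≤ n → n ≤ (S.block j).card →
      κ * (n : ℝ) ^ (k + 1) ≤ (entropy ((S.graph (k + 1)).sampleLaw S.measure n)).toReal := by
  obtain ⟨κ, hκ, t, ht⟩ := exists_forall_le_bits k j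
  set c : ℝ := 2⁻¹ ^ (j + 1) / 4 * (2⁻¹ ^ (j + 2) / 2) with hc
  have hc0 : 0 < c := by positivity
  obtain ⟨t', ht'⟩ := exists_nat_ge (2 * Real.logb 2 (2 / c) / κ)
  refine ⟨c / 4 * κ, by positivity, max t (max t' 2), fun S n hn hS => ?_⟩
  have hn2 : 2 ≤ n := (le_max_right _ _).trans ((le_max_right _ _).trans hn)
  have hnt : t ≤ n := (le_max_left _ _).trans hn
  have hnt' : 2 * Real.logb 2 (2 / c) / κ ≤ n :=
    ht'.trans (by exact_mod_cast (le_max_left _ _).trans ((le_max_right _ _).trans hn))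
  refine le_trans ?_ (S.le_toReal_entropy_sampleLaw (k := k) j n hn2 hS)
  rw [← hc]
  have h1 := ht n hnt
  have h2 : (n : ℝ) ≤ n ^ (k + 1) :=
    le_self_pow₀ (by exact_mod_cast (by omega : 1 ≤ n)) (by omega)
  rw [div_le_iff₀ hκ] at hnt'
  have h3 := mul_le_mul_of_nonneg_right h2 hκ.le
  have h4 : κ / 2 * (n : ℝ) ^ (k + 1) ≤ bits k j n - Real.logb 2 (2 / c) := by linarith
  calc c / 4 * κ * (n : ℝ) ^ (k + 1) = c / 2 * (κ / 2 * (n : ℝ) ^ (k + 1)) := by ring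
    _ ≤ _ := mul_le_mul_of_nonneg_left h4 (by positivity)

/-- For suitable block sizes, the entropy of samples from a block system has at least the order
`γ n * n ^ (k + 1)`. -/
theorem exists_eventually_le_toReal_entropy (k : ℕ) {γ : ℕ → ℝ}
    (hγ : Tendsto γ atTop (nhds 0)) :
    ∃ S : BlockSystem, ∀ᶠ n : ℕ in atTop, γ n * (n : ℝ) ^ (k + 1) ≤
      (entropy ((S.graph (k + 1)).sampleLaw S.measure n)).toReal := by
  choose κ hκ t ht using exists_forall_le_toReal_entropy k
  have hN : ∀ j, ∃ N, ∀ n, N ≤ n → t j ≤ n ∧ γ n ≤ κ j := fun j => by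
    have h := (eventually_ge_atTop (t j)).and (hγ.eventually_le_const (hκ j))
    exact eventually_atTop.1 h
  choose N hN using hN
  -- Blocks `j` and `j + 1` serve the sample sizes from `M j` to `M (j + 1)`.
  let M : ℕ → ℕ := fun j => ∑ i ∈ Finset.range (j + 1), (N i + 1)
  have hMN : ∀ j, N j ≤ M j := fun j => by
    simp only [M, Finset.sum_range_succ]; omega
  have hMmono : StrictMono M := strictMono_nat_of_lt_succ fun j => by
    simp only [M, Finset.sum_range_succ _ (j + 1)]; omega
  obtain ⟨S, hS⟩ := exists_le_card fun j => M (j + 1)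
  refine ⟨S, eventually_atTop.2 ⟨M 0, fun n hn => ?_⟩⟩
  have hex : ∃ j, n < M (j + 1) := ⟨n, (Nat.lt_succ_self n).trans_le (hMmono.le_apply)⟩
  classical
  let j := Nat.find hex
  have hj : n < M (j + 1) := Nat.find_spec hex
  have hj' : M j ≤ n := by
    rcases Nat.eq_zero_or_pos j with h | h
    · rw [h]; exact hn
    · have := Nat.find_min hex (Nat.sub_lt h one_pos)
      rwa [not_lt, show Nat.find hex - 1 + 1 = j from Nat.sub_add_cancel h] at this
  obtain ⟨h1, h2⟩ := hN j n ((hMN j).trans hj')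
  exact (mul_le_mul_of_nonneg_right h2 (by positivity)).trans
    (ht j S n h1 (hj.le.trans (hS j)))

end BlockSystem

theorem mainTheorem3 (k : ℕ) (hk : 2 ≤ k) (γ : ℕ → ℝ) (hγ : ∀ n, γ n ∈ Set.Icc (0 : ℝ) 1)
    (hγ_lim : Tendsto γ atTop (nhds 0)) :
    ∃ W : ExtHypergraphon k,
      W.InducesBorelHypergraph ∧
      (∃ R : Str k ℕ, R.IsRado ∧ ∃ π : unitInterval → ℕ, W.IsBlowUp hk π R) ∧
      (∀ n, entropyFunction W.law n ≠ ⊤) ∧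
      (fun n => (entropyFunction W.law n).toReal) =o[atTop] (fun n : ℕ => (n : ℝ) ^ k) ∧
      (fun n : ℕ => γ n * (n : ℝ) ^ k) =O[atTop] (fun n => (entropyFunction W.law n).toReal) := by
  obtain ⟨k, rfl⟩ : ∃ k', k = k' + 1 := ⟨k - 1, by omega⟩
  obtain ⟨S, hS⟩ := BlockSystem.exists_eventually_le_toReal_entropy k hγ_lim
  obtain ⟨π, hπ, hmap⟩ := S.measure.exists_measurable_map_eq
  have hpos : ∀ i, 0 < volume (π ⁻¹' {i}) := fun i => by
    rw [← Measure.map_apply hπ (measurableSet_singleton i), hmap]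
    exact S.measure_singleton_pos i
  have hR := S.graph_isHypergraph (k + 1)
  have hW := ExtHypergraphon.blowUp_isBlowUp hk hπ hpos hR
  set W := ExtHypergraphon.blowUp hk hπ hR
  have hlaw : ∀ n, entropyFunction W.law n =
      entropy ((S.graph (k + 1)).sampleLaw S.measure n) := fun n => by
    rw [entropyFunction, hW.map_restrict_law hR, hmap, Str.sampleLaw]
  refine ⟨W, hW.inducesBorelHypergraph, ⟨_, S.graph_isRado _, π, hW⟩, fun n => ?_,
    ?_, Asymptotics.IsBigO.of_bound 1 ?_⟩
  · rw [hlaw, entropy_eq_ofReal_sum]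
    exact ENNReal.ofReal_ne_top
  · simp_rw [hlaw]
    exact Str.isLittleO_toReal_entropy_sampleLaw hk _ _
  · filter_upwards [hS] with n hn
    rw [one_mul, Real.norm_of_nonneg (mul_nonneg (hγ n).1 (by positivity)),
      Real.norm_of_nonneg ENNReal.toReal_nonneg, hlaw]
    exact hn
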